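/- Let $\mathcal E$ be a (finite-dimensional, Hausdorff, second countable) smooth manifold, let $M \subseteq \mathcal E$ be an embedded submanifold of positive codimension, and let $\pi : E = T\mathcal E|_M / TM \to M$ be its normal bundle, with fiberwise scalar multiplication $h_t : E \to E$, $t \in \mathbb R$. A symmetric $q$-multivector on a manifold is a section of the $q$-th symmetric power of the tangent bundle, viewed as a symmetric $\mathbb R$-multilinear map $P : C^\infty \times \cdots \times C^\infty \to C^\infty$ in $q$ arguments that is a derivation in each argument ($q \ge 0$; for $q = 0$ it is a function). The symmetric product of a $p$-multivector $P$ and a $q$-multivector $Q$ is the $(p+q)$-multivector $(P \odot Q)(f_1, \ldots, f_{p+q}) = \sum_{\sigma \in S_{p,q}} P(f_{\sigma(1)}, \ldots, f_{\sigma(p)})\, Q(f_{\sigma(p+1)}, \ldots, f_{\sigma(p+q)})$, and for $p + q \ge 1$ their Poisson bracket is the $(p+q-1)$-multivector $$\{P, Q\}(f_1, \ldots, f_{p+q-1}) = \sum_{\sigma \in S_{q,p-1}} P\big(Q(f_{\sigma(1)}, \ldots, f_{\sigma(q)}), f_{\sigma(q+1)}, \ldots, f_{\sigma(p+q-1)}\big)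 - \sum_{\sigma \in S_{p,q-1}} Q\big(P(f_{\sigma(1)}, \ldots, f_{\sigma(p)}), f_{\sigma(p+1)}, \ldots, f_{\sigma(p+q-1)}\big),$$ where $S_{k,l}$ is the set of $(k,l)$-unshuffles (empty if $l = -1$); the bracket of two functions is $0$. A symmetric $q$-multivector $R$ on $E$ is fiberwise linear (FWL) if $h_t^* R = t^{1-q} R$ for all $t \ne 0$. A function $F \in C^\infty(\mathcal E)$ is linearizable if $F|_M = 0$; its linearization $F_{\mathrm{lin}} \in C^\infty(E)$ is the fiberwise linear function $F_{\mathrm{lin}}(x, v \bmod T_xM) = dF_x(v)$. A symmetric $q$-multivector $P$ on $\mathcal E$ is linearizable ($M$ is coisotropic with respect to $P$) if it lies in the graded ideal $\mathcal I_M$, with respect to $\odot$, generated by the vector fields on $\mathcal E$ that are tangent to $M$ and the functions that vanish on $M$ (the functions only matter in degree $q = 0$: in degrees $q \ge 1$ the tangent vector fields alone generate the same ideal). **Proposition.** (1) Let $q \ge 0$ and let $P$ be a linearizable symmetric $q$-multivector on $\mathcal E$. Then there is a unique FWL symmetric $q$-multivector $P_{\mathrm{lin}}$ on $E$ such that, for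 all linearizable functions $F_1, \ldots, F_q \in C^\infty(\mathcal E)$, the function $P(F_1, \ldots, F_q)$ is linearizable and $$P_{\mathrm{lin}}\big((F_1)_{\mathrm{lin}}, \ldots, (F_q)_{\mathrm{lin}}\big) = P(F_1, \ldots, F_q)_{\mathrm{lin}}.$$ (2) Let $P$ and $Q$ be linearizable symmetric multivectors on $\mathcal E$, of degrees $p$ and $q$ with $p + q \ge 1$. Then $\{P, Q\}$ is linearizable, and $\{P, Q\}_{\mathrm{lin}} = \{P_{\mathrm{lin}}, Q_{\mathrm{lin}}\}$. -/

import Mathlib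

open scoped Manifold ContDiff Topology
open Bundle Function

noncomputable section

/-! ## Symmetric multiderivations of a commutative algebra -/

/-- A symmetric `q`-multiderivation of a commutative `ℝ`-algebra `A`: a symmetric `ℝ`-multilinear
map `A × ⋯ × A → A` that is a derivation in each argument.  For `A = C^∞(N)` these are exactly the
symmetric `q`-multivector fields on `N` (sections of `S^q TN`), acting on functions. -/
structure SymMultider (A : Type*) [CommRing A] [Algebra ℝ A] (q : ℕ) extends
    MultilinearMap ℝ (fun _ : Fin q => A) A where
  map_perm' : ∀ (σ : Equiv.Perm (Fin q)) (f : Fin q → A), toFun (f ∘ σ) = toFun f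
  leibniz' : ∀ (f : Fin q → A) (i : Fin q) (a b : A),
    toFun (update f i (a * b)) = a * toFun (update f i b) + b * toFun (update f i a)

theorem exists_perm_of_map_univ_eq {ι A : Type*} [Fintype ι] {f g : ι → A}
    (h : (Finset.univ.val.map f : Multiset A) = Finset.univ.val.map g) :
    ∃ σ : Equiv.Perm ι, f ∘ σ = g := by
  classical
  have hc : ∀ a, Fintype.card {i // g i = a} = Fintype.card {i // f i = a} := by
    intro a
    have := congrArg (Multiset.count a) h
    simp only [Multiset.count_map] at this
    rw [Fintype.card_subtype, Fintype.card_subtype]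
    simp only [Finset.card_def, Finset.filter_val]
    rw [Multiset.filter_congr (fun x _ => eq_comm (a := g x)),
      Multiset.filter_congr (fun x _ => eq_comm (a := f x))]
    exact this.symm
  let e : ∀ a, {i // g i = a} ≃ {i // f i = a} := fun a => Fintype.equivOfCardEq (hc a)
  refine ⟨(Equiv.sigmaFiberEquiv g).symm.trans
    ((Equiv.sigmaCongrRight e).trans (Equiv.sigmaFiberEquiv f)), ?_⟩
  funext i
  exact (e (g i) ⟨i, rfl⟩).2

namespace SymMultider

variable {A : Type*} [CommRing A] [Algebra ℝ A]

instance (q : ℕ) : FunLike (SymMultider A q) (Fin q → A) A where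
  coe P := P.toMultilinearMap
  coe_injective := by
    rintro ⟨P, _, _⟩ ⟨Q, _, _⟩ h
    congr
    exact DFunLike.coe_injective h

@[ext] theorem ext {q : ℕ} {P Q : SymMultider A q} (h : ∀ f, P f = Q f) : P = Q :=
  DFunLike.ext _ _ h

theorem map_perm {q : ℕ} (P : SymMultider A q) (σ : Equiv.Perm (Fin q)) (f : Fin q → A) :
    P (f ∘ σ) = P f := P.map_perm' σ f

theorem leibniz {q : ℕ} (P : SymMultider A q) (f : Fin q → A) (i : Fin q) (a b : A) :
    P (update f i (a * b)) = a * P (update f i b) + b * P (update f i a) := P.leibniz' f i a b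

theorem map_add {q : ℕ} (P : SymMultider A q) (f : Fin q → A) (i : Fin q) (a b : A) :
    P (update f i (a + b)) = P (update f i a) + P (update f i b) :=
  P.toMultilinearMap.map_update_add f i a b

theorem map_smul {q : ℕ} (P : SymMultider A q) (f : Fin q → A) (i : Fin q) (c : ℝ) (a : A) :
    P (update f i (c • a)) = c • P (update f i a) :=
  P.toMultilinearMap.map_update_smul f i c a

instance (q : ℕ) : Zero (SymMultider A q) :=
  ⟨{ (0 : MultilinearMap ℝ (fun _ : Fin q => A) A) with
      map_perm' := fun _ _ => rfl
      leibniz' := fun _ _ a b => by simp }⟩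

instance (q : ℕ) : Add (SymMultider A q) :=
  ⟨fun P Q => { P.toMultilinearMap + Q.toMultilinearMap with
      map_perm' := fun σ f => congrArg₂ (· + ·) (P.map_perm σ f) (Q.map_perm σ f)
      leibniz' := fun f i a b => by
        have h1 := P.leibniz f i a b
        have h2 := Q.leibniz f i a b
        change P _ + Q _ = a * (P _ + Q _) + b * (P _ + Q _)
        rw [h1, h2]; ring }⟩

theorem zero_apply {q : ℕ} (f : Fin q → A) : (0 : SymMultider A q) f = 0 := rfl

theorem add_apply {q : ℕ} (P Q : SymMultider A q) (f : Fin q → A) : (P + Q) f = P f + Q f := rfl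

/-- The `0`-multivector given by an element of the algebra. -/
def ofElem (a : A) : SymMultider A 0 :=
  { MultilinearMap.constOfIsEmpty ℝ (fun _ : Fin 0 => A) a with
    map_perm' := fun _ _ => rfl
    leibniz' := fun _ i => i.elim0 }

/-- The value of `P` on a multiset of `q` arguments (their order is irrelevant, as `P` is
symmetric); multisets of another cardinality get the value `0`. -/
def eval {q : ℕ} (P : SymMultider A q) (s : Multiset A) : A :=
  if h : s.toList.length = q then P (fun i => s.toList.get (i.cast h.symm)) else 0

theorem eval_map_univ {q : ℕ} (P : SymMultider A q) (f : Fin q → A) :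
    P.eval (Finset.univ.val.map f) = P f := by
  set s : Multiset A := Finset.univ.val.map f with hs
  have hlen : s.toList.length = q := by simp [hs]
  rw [eval, dif_pos hlen]
  obtain ⟨σ, hσ⟩ : ∃ σ : Equiv.Perm (Fin q),
      f ∘ σ = fun i : Fin q => s.toList.get (i.cast hlen.symm) := by
    apply exists_perm_of_map_univ_eq
    rw [← hs, Fin.univ_val_map]
    have : List.ofFn (fun i : Fin q => s.toList.get (i.cast hlen.symm)) = s.toList := by
      apply List.ext_get
      · simp [hlen]
      · intro n h1 h2; simp
    rw [this, Multiset.coe_toList]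
  rw [← hσ, P.map_perm]

theorem eval_of_card_ne {q : ℕ} (P : SymMultider A q) {s : Multiset A} (h : s.card ≠ q) :
    P.eval s = 0 := by
  rw [eval, dif_neg]; simpa using h

theorem eval_cons {q : ℕ} (P : SymMultider A q) {s : Multiset A} (h : s.card + 1 = q) :
    ∃ (f : Fin q → A) (i : Fin q), ∀ x, P.eval (x ::ₘ s) = P (update f i x) := by
  subst h
  obtain ⟨l, rfl⟩ := Quot.exists_rep s
  refine ⟨Fin.cons 0 (fun i => l.get i), 0, fun x => ?_⟩
  rw [← eval_map_univ, Fin.update_cons_zero, Fin.univ_val_map]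
  congr 1
  change (x ::ₘ (↑l : Multiset A)) = _
  rw [Multiset.cons_coe]
  congr 1
  simp

theorem eval_cons_add {q : ℕ} (P : SymMultider A q) (s : Multiset A) (a b : A) :
    P.eval ((a + b) ::ₘ s) = P.eval (a ::ₘ s) + P.eval (b ::ₘ s) := by
  by_cases h : s.card + 1 = q
  · obtain ⟨f, i, hf⟩ := P.eval_cons h
    simp only [hf, P.map_add]
  · simp [eval_of_card_ne, h]

theorem eval_cons_smul {q : ℕ} (P : SymMultider A q) (s : Multiset A) (c : ℝ) (a : A) :
    P.eval ((c • a) ::ₘ s) = c • P.eval (a ::ₘ s) := by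
  by_cases h : s.card + 1 = q
  · obtain ⟨f, i, hf⟩ := P.eval_cons h
    simp only [hf, P.map_smul]
  · simp [eval_of_card_ne, h]

theorem eval_cons_mul {q : ℕ} (P : SymMultider A q) (s : Multiset A) (a b : A) :
    P.eval ((a * b) ::ₘ s) = a * P.eval (b ::ₘ s) + b * P.eval (a ::ₘ s) := by
  by_cases h : s.card + 1 = q
  · obtain ⟨f, i, hf⟩ := P.eval_cons h
    simp only [hf, P.leibniz]
  · simp [eval_of_card_ne, h]

/-- The multiset of the arguments `f i` with `i ∈ S`. -/
def args {A : Type*} {n : ℕ} (f : Fin n → A) (S : Finset (Fin n)) : Multiset A := S.val.map f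

theorem args_update_of_notMem {A : Type*} {n : ℕ} (f : Fin n → A) {S : Finset (Fin n)} {i : Fin n}
    (h : i ∉ S) (x : A) : args (update f i x) S = args f S := by
  refine Multiset.map_congr rfl fun j hj => update_of_ne ?_ x f
  rintro rfl; exact h hj

theorem args_update_of_mem {A : Type*} {n : ℕ} (f : Fin n → A) {S : Finset (Fin n)} {i : Fin n}
    (h : i ∈ S) (x : A) : args (update f i x) S = x ::ₘ args f (S.erase i) := by
  conv_lhs => rw [← Finset.insert_erase h]
  rw [args, Finset.insert_val_of_notMem (Finset.notMem_erase i S), Multiset.map_cons, update_self]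
  congr 1
  exact args_update_of_notMem f (Finset.notMem_erase i S) x

theorem args_comp {A : Type*} {n : ℕ} (f : Fin n → A) (σ : Equiv.Perm (Fin n)) (S : Finset (Fin n)) :
    args (f ∘ σ) S = args f (S.map σ.toEmbedding) := by
  simp [args, Finset.map_val, Multiset.map_map]

/-- Constructor from a plain function. -/
def ofFun {n : ℕ} (F : (Fin n → A) → A)
    (hadd : ∀ f i a b, F (update f i (a + b)) = F (update f i a) + F (update f i b))
    (hsmul : ∀ f i (c : ℝ) a, F (update f i (c • a)) = c • F (update f i a))
    (hperm : ∀ (σ : Equiv.Perm (Fin n)) f, F (f ∘ σ) = F f)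
    (hleib : ∀ f i a b, F (update f i (a * b)) = a * F (update f i b) + b * F (update f i a)) :
    SymMultider A n where
  toFun := F
  map_update_add' {inst} f i a b := by
    rw [Subsingleton.elim inst (instDecidableEqFin _)]; exact hadd f i a b
  map_update_smul' {inst} f i c a := by
    rw [Subsingleton.elim inst (instDecidableEqFin _)]; exact hsmul f i c a
  map_perm' := hperm
  leibniz' := hleib

theorem sum_powersetCard_perm {A : Type*} [AddCommMonoid A] {n k : ℕ}
    (σ : Equiv.Perm (Fin n)) (G : Finset (Fin n) → A) :
    ∑ S ∈ Finset.powersetCard k Finset.univ, G (S.map σ.toEmbedding) =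
      ∑ S ∈ Finset.powersetCard k Finset.univ, G S :=
  Finset.sum_equiv (Equiv.finsetCongr σ) (fun S => by simp [Finset.mem_powersetCard])
    (fun S _ => by simp)

theorem map_perm_compl {n : ℕ} (σ : Equiv.Perm (Fin n)) (S : Finset (Fin n)) :
    Sᶜ.map σ.toEmbedding = (S.map σ.toEmbedding)ᶜ := by
  ext x; simp

/-- The symmetric product, `(P ⊙ Q)(f) = ∑_S P(f_S) Q(f_{Sᶜ})`, the sum being over all
`p`-element subsets `S` of the index set, i.e. over all `(p, q)`-unshuffles. -/
def mul {p q : ℕ} (P : SymMultider A p) (Q : SymMultider A q) : SymMultider A (p + q) :=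
  ofFun (fun f => ∑ S ∈ Finset.powersetCard p Finset.univ, P.eval (args f S) * Q.eval (args f Sᶜ))
    (fun f i a b => by
      rw [← Finset.sum_add_distrib]
      refine Finset.sum_congr rfl fun S _ => ?_
      by_cases h : i ∈ S
      · have h' : i ∉ Sᶜ := by simpa using h
        simp only [args_update_of_mem f h, args_update_of_notMem f h', eval_cons_add]; ring
      · have h' : i ∈ Sᶜ := by simpa using h
        simp only [args_update_of_mem f h', args_update_of_notMem f h, eval_cons_add]; ring)
    (fun f i c a => by
      rw [Finset.smul_sum]
      refine Finset.sum_congr rfl fun S _ => ?_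
      by_cases h : i ∈ S
      · have h' : i ∉ Sᶜ := by simpa using h
        simp only [args_update_of_mem f h, args_update_of_notMem f h', eval_cons_smul,
          smul_mul_assoc]
      · have h' : i ∈ Sᶜ := by simpa using h
        simp only [args_update_of_mem f h', args_update_of_notMem f h, eval_cons_smul,
          mul_smul_comm])
    (fun σ f => by
      simp only [args_comp, map_perm_compl]
      exact sum_powersetCard_perm σ (fun S => P.eval (args f S) * Q.eval (args f Sᶜ)))
    (fun f i a b => by
      simp only [Finset.mul_sum]
      rw [← Finset.sum_add_distrib]
      refine Finset.sum_congr rfl fun S _ => ?_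
      by_cases h : i ∈ S
      · have h' : i ∉ Sᶜ := by simpa using h
        simp only [args_update_of_mem f h, args_update_of_notMem f h', eval_cons_mul]; ring
      · have h' : i ∈ Sᶜ := by simpa using h
        simp only [args_update_of_mem f h', args_update_of_notMem f h, eval_cons_mul]; ring)

theorem mul_apply {p q : ℕ} (P : SymMultider A p) (Q : SymMultider A q) (f : Fin (p + q) → A) :
    P.mul Q f =
      ∑ S ∈ Finset.powersetCard p Finset.univ, P.eval (args f S) * Q.eval (args f Sᶜ) := rfl

/-- One half of the bracket: `∑_S P(Q(f_S), f_{Sᶜ})`, the sum being over all `q`-element subsets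
`S` of the index set, i.e. over all `(q, p - 1)`-unshuffles if `n = p + q - 1`. -/
def insertion {p q : ℕ} (P : SymMultider A p) (Q : SymMultider A q) {n : ℕ} (f : Fin n → A) : A :=
  ∑ S ∈ Finset.powersetCard q Finset.univ, P.eval (Q.eval (args f S) ::ₘ args f Sᶜ)

theorem insertion_add {p q n : ℕ} (P : SymMultider A p) (Q : SymMultider A q)
    (f : Fin n → A) (i : Fin n) (a b : A) :
    P.insertion Q (update f i (a + b)) =
      P.insertion Q (update f i a) + P.insertion Q (update f i b) := by
  simp only [insertion]
  rw [← Finset.sum_add_distrib]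
  refine Finset.sum_congr rfl fun S _ => ?_
  by_cases h : i ∈ S
  · have h' : i ∉ Sᶜ := by simpa using h
    simp only [args_update_of_mem f h, args_update_of_notMem f h', eval_cons_add]
  · have h' : i ∈ Sᶜ := by simpa using h
    simp only [args_update_of_mem f h', args_update_of_notMem f h,
      Multiset.cons_swap (Q.eval _), eval_cons_add]

theorem insertion_smul {p q n : ℕ} (P : SymMultider A p) (Q : SymMultider A q)
    (f : Fin n → A) (i : Fin n) (c : ℝ) (a : A) :
    P.insertion Q (update f i (c • a)) = c • P.insertion Q (update f i a) := by
  simp only [insertion]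
  rw [Finset.smul_sum]
  refine Finset.sum_congr rfl fun S _ => ?_
  by_cases h : i ∈ S
  · have h' : i ∉ Sᶜ := by simpa using h
    simp only [args_update_of_mem f h, args_update_of_notMem f h', eval_cons_smul]
  · have h' : i ∈ Sᶜ := by simpa using h
    simp only [args_update_of_mem f h', args_update_of_notMem f h,
      Multiset.cons_swap (Q.eval _), eval_cons_smul]

theorem insertion_perm {p q n : ℕ} (P : SymMultider A p) (Q : SymMultider A q)
    (σ : Equiv.Perm (Fin n)) (f : Fin n → A) : P.insertion Q (f ∘ σ) = P.insertion Q f := by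
  simp only [insertion, args_comp, map_perm_compl]
  exact sum_powersetCard_perm σ (fun S => P.eval (Q.eval (args f S) ::ₘ args f Sᶜ))

/-- The mixed terms by which an insertion fails to be a derivation in the `i`-th argument. -/
def mixed {p q n : ℕ} (P : SymMultider A p) (Q : SymMultider A q) (f : Fin n → A) (i : Fin n)
    (a b : A) : A :=
  ∑ S ∈ (Finset.powersetCard q Finset.univ).filter (fun S => i ∈ S),
    (Q.eval (b ::ₘ args f (S.erase i)) * P.eval (a ::ₘ args f Sᶜ) +
      Q.eval (a ::ₘ args f (S.erase i)) * P.eval (b ::ₘ args f Sᶜ))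

theorem insertion_mul {p q n : ℕ} (P : SymMultider A p) (Q : SymMultider A q)
    (f : Fin n → A) (i : Fin n) (a b : A) :
    P.insertion Q (update f i (a * b)) =
      a * P.insertion Q (update f i b) + b * P.insertion Q (update f i a) +
        P.mixed Q f i a b := by
  simp only [insertion, mixed, Finset.mul_sum]
  rw [Finset.sum_filter, ← Finset.sum_add_distrib, ← Finset.sum_add_distrib]
  refine Finset.sum_congr rfl fun S _ => ?_
  by_cases h : i ∈ S
  · have h' : i ∉ Sᶜ := by simpa using h
    simp only [args_update_of_mem f h, args_update_of_notMem f h', eval_cons_add, eval_cons_mul,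
      if_pos h]
    ring
  · have h' : i ∈ Sᶜ := by simpa using h
    simp only [args_update_of_mem f h', args_update_of_notMem f h,
      Multiset.cons_swap (Q.eval _), eval_cons_mul, if_neg h]
    ring

theorem mixed_comm {p q n : ℕ} (h : p + q = n + 1) (P : SymMultider A p) (Q : SymMultider A q)
    (f : Fin n → A) (i : Fin n) (a b : A) : P.mixed Q f i a b = Q.mixed P f i a b := by
  have hcard : ∀ {k l : ℕ}, k + l = n + 1 → ∀ S : Finset (Fin n),
      S ∈ (Finset.powersetCard k Finset.univ).filter (fun S => i ∈ S) →
      insert i Sᶜ ∈ (Finset.powersetCard l Finset.univ).filter (fun S => i ∈ S) := by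
    intro k l hkl S hS
    simp only [Finset.mem_filter, Finset.mem_powersetCard, Finset.subset_univ, true_and] at hS ⊢
    refine ⟨?_, Finset.mem_insert_self _ _⟩
    have hi : i ∉ Sᶜ := by simpa using hS.2
    rw [Finset.card_insert_of_notMem hi, Finset.card_compl, Fintype.card_fin, hS.1]
    have := Finset.card_le_univ S
    rw [Fintype.card_fin, hS.1] at this
    omega
  have hinv : ∀ S : Finset (Fin n), i ∈ S → insert i (insert i Sᶜ)ᶜ = S := by
    intro S hS
    ext x
    by_cases hx : x = i <;> simp [hx, hS]
  have hc : ∀ S : Finset (Fin n), i ∈ S → (insert i Sᶜ)ᶜ = S.erase i := by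
    intro S hS
    ext x
    by_cases hx : x = i <;> simp [hx]
  have he : ∀ S : Finset (Fin n), i ∈ S → (insert i Sᶜ).erase i = Sᶜ := by
    intro S hS
    exact Finset.erase_insert (by simpa using hS)
  refine Finset.sum_nbij' (fun S => insert i Sᶜ) (fun S => insert i Sᶜ)
    (hcard (by omega)) (hcard (by omega)) ?_ ?_ ?_
  · intro S hS; exact hinv S (Finset.mem_filter.1 hS).2
  · intro S hS; exact hinv S (Finset.mem_filter.1 hS).2
  · intro S hS
    have hi := (Finset.mem_filter.1 hS).2
    rw [hc S hi, he S hi]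
    ring

/-- The Poisson bracket of symmetric multivectors of degrees `p` and `q`, of degree
`n = p + q - 1`:
`{P, Q}(f) = ∑_S P(Q(f_S), f_{Sᶜ}) - ∑_T Q(P(f_T), f_{Tᶜ})`, with `#S = q` and `#T = p`.
If `p = 0` (resp. `q = 0`), the first (resp. second) sum is empty. -/
def bracket {p q n : ℕ} (h : p + q = n + 1) (P : SymMultider A p) (Q : SymMultider A q) :
    SymMultider A n :=
  ofFun (fun f => P.insertion Q f - Q.insertion P f)
    (fun f i a b => by simp only [insertion_add]; ring)
    (fun f i c a => by simp only [insertion_smul, smul_sub])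
    (fun σ f => by simp only [insertion_perm])
    (fun f i a b => by simp only [insertion_mul, mixed_comm h P Q]; ring)

theorem bracket_apply {p q n : ℕ} (h : p + q = n + 1) (P : SymMultider A p)
    (Q : SymMultider A q) (f : Fin n → A) :
    bracket h P Q f = P.insertion Q f - Q.insertion P f := rfl

end SymMultider

/-! ## Embedded submanifolds and their normal bundles -/

/-- An embedded submanifold of `N` (a manifold modelled on `V`): a manifold `M` modelled on `W`
with a smooth embedding into `N`. -/
structure EmbeddedSubmanifold (V : Type*) [NormedAddCommGroup V] [NormedSpace ℝ V]
    (N : Type*) [TopologicalSpace N] [ChartedSpace V N]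
    (W : Type*) [NormedAddCommGroup W] [NormedSpace ℝ W]
    (M : Type*) [TopologicalSpace M] [ChartedSpace W M] where
  /-- the inclusion of the submanifold -/
  incl : M → N
  isSmoothEmbedding : Manifold.IsSmoothEmbedding 𝓘(ℝ, W) 𝓘(ℝ, V) ∞ incl

/-- The model fiber of the normal bundle, a Euclidean space of dimension `dim N - dim M`. -/
abbrev NormalModel (V W : Type*) [NormedAddCommGroup V] [NormedSpace ℝ V]
    [NormedAddCommGroup W] [NormedSpace ℝ W] : Type :=
  EuclideanSpace ℝ (Fin (Module.finrank ℝ V - Module.finrank ℝ W))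

namespace EmbeddedSubmanifold

set_option linter.unusedSectionVars false

variable {V : Type*} [NormedAddCommGroup V] [NormedSpace ℝ V]
  {N : Type*} [TopologicalSpace N] [ChartedSpace V N]
  {W : Type*} [NormedAddCommGroup W] [NormedSpace ℝ W]
  {M : Type*} [TopologicalSpace M] [ChartedSpace W M]

/-- The differential of the inclusion. -/
def dincl (S : EmbeddedSubmanifold V N W M) (x : M) :
    TangentSpace 𝓘(ℝ, W) x →L[ℝ] TangentSpace 𝓘(ℝ, V) (S.incl x) :=
  mfderiv 𝓘(ℝ, W) 𝓘(ℝ, V) S.incl x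

/-- The fiber `T_xN / T_xM` of the normal bundle. -/
def NormalSpace (S : EmbeddedSubmanifold V N W M) (x : M) : Type _ :=
  TangentSpace 𝓘(ℝ, V) (S.incl x) ⧸ (S.dincl x).range

instance (S : EmbeddedSubmanifold V N W M) (x : M) : AddCommGroup (S.NormalSpace x) :=
  inferInstanceAs (AddCommGroup (TangentSpace 𝓘(ℝ, V) (S.incl x) ⧸ (S.dincl x).range))

instance (S : EmbeddedSubmanifold V N W M) (x : M) : Module ℝ (S.NormalSpace x) :=
  inferInstanceAs (Module ℝ (TangentSpace 𝓘(ℝ, V) (S.incl x) ⧸ (S.dincl x).range))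

instance (S : EmbeddedSubmanifold V N W M) (x : M) : TopologicalSpace (S.NormalSpace x) :=
  inferInstanceAs (TopologicalSpace (TangentSpace 𝓘(ℝ, V) (S.incl x) ⧸ (S.dincl x).range))

/-- The projection `T_xN → T_xN / T_xM`. -/
def normalMk (S : EmbeddedSubmanifold V N W M) (x : M) :
    TangentSpace 𝓘(ℝ, V) (S.incl x) →ₗ[ℝ] S.NormalSpace x := (S.dincl x).range.mkQ

theorem normalMk_surjective (S : EmbeddedSubmanifold V N W M) (x : M) :
    Surjective (S.normalMk x) := Submodule.mkQ_surjective _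

theorem normalMk_eq_zero (S : EmbeddedSubmanifold V N W M) (x : M)
    (v : TangentSpace 𝓘(ℝ, V) (S.incl x)) :
    S.normalMk x v = 0 ↔ v ∈ (S.dincl x).range :=
  Submodule.Quotient.mk_eq_zero _

/-- Adapted coordinates: a chart `cod` of `N` and a chart `dom` of `M` in which the inclusion is
`w ↦ (w, 0)`, for an identification of `V` with `W × NormalModel V W`. -/
structure AdaptedChart (S : EmbeddedSubmanifold V N W M) where
  dom : OpenPartialHomeomorph M W
  cod : OpenPartialHomeomorph N V
  split : (W × NormalModel V W) ≃L[ℝ] V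
  dom_mem : dom ∈ IsManifold.maximalAtlas 𝓘(ℝ, W) ∞ M
  cod_mem : cod ∈ IsManifold.maximalAtlas 𝓘(ℝ, V) ∞ N
  source_subset : dom.source ⊆ S.incl ⁻¹' cod.source
  cod_incl : ∀ x ∈ dom.source, cod (S.incl x) = split (dom x, 0)

theorem exists_adaptedChart [FiniteDimensional ℝ V] [FiniteDimensional ℝ W]
    (S : EmbeddedSubmanifold V N W M) (x : M) :
    ∃ c : S.AdaptedChart, x ∈ c.dom.source := by
  obtain ⟨F, _, _, hF⟩ := S.isSmoothEmbedding.isImmersion.isImmersionAt x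
  have : FiniteDimensional ℝ F := by
    have : FiniteDimensional ℝ (W × F) :=
      hF.equiv.symm.toLinearEquiv.finiteDimensional
    exact FiniteDimensional.of_surjective (LinearMap.snd ℝ W F) LinearMap.snd_surjective
  have hdim : Module.finrank ℝ F = Module.finrank ℝ (NormalModel V W) := by
    have h1 := hF.equiv.toLinearEquiv.finrank_eq
    rw [Module.finrank_prod] at h1
    rw [finrank_euclideanSpace_fin]
    omega
  have e : F ≃L[ℝ] NormalModel V W := ContinuousLinearEquiv.ofFinrankEq hdim
  have h := hF.trans_F e
  refine ⟨⟨h.domChart, h.codChart, h.equiv, h.domChart_mem_maximalAtlas,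
    h.codChart_mem_maximalAtlas, h.source_subset_preimage_source, fun y hy => ?_⟩,
    h.mem_domChart_source⟩
  have hmem : h.domChart y ∈ (h.domChart.extend 𝓘(ℝ, W)).target := by
    simpa using h.domChart.map_source hy
  have := h.writtenInCharts hmem
  simpa [h.domChart.left_inv hy] using this

namespace AdaptedChart

variable {S : EmbeddedSubmanifold V N W M} (c : S.AdaptedChart)

/-- The differential of the transverse coordinates. -/
def coord (x : M) : TangentSpace 𝓘(ℝ, V) (S.incl x) →L[ℝ] NormalModel V W :=
  ((ContinuousLinearMap.snd ℝ W (NormalModel V W)).comp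
    (c.split.symm : V →L[ℝ] W × NormalModel V W)).comp
    (mfderiv 𝓘(ℝ, V) 𝓘(ℝ, V) c.cod (S.incl x))

/-- The vectors tangent to the transverse coordinate directions. -/
def lift (x : M) : NormalModel V W →L[ℝ] TangentSpace 𝓘(ℝ, V) (S.incl x) :=
  (mfderiv 𝓘(ℝ, V) 𝓘(ℝ, V) c.cod.symm (c.cod (S.incl x))).comp
    ((c.split : W × NormalModel V W →L[ℝ] V).comp
      (ContinuousLinearMap.inr ℝ W (NormalModel V W)))

theorem cod_mdiff [IsManifold 𝓘(ℝ, V) ∞ N] :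
    c.cod.MDifferentiable 𝓘(ℝ, V) 𝓘(ℝ, V) :=
  ⟨(contMDiffOn_of_mem_maximalAtlas c.cod_mem).mdifferentiableOn (by simp),
    (contMDiffOn_symm_of_mem_maximalAtlas c.cod_mem).mdifferentiableOn (by simp)⟩

theorem dom_mdiff [IsManifold 𝓘(ℝ, W) ∞ M] :
    c.dom.MDifferentiable 𝓘(ℝ, W) 𝓘(ℝ, W) :=
  ⟨(contMDiffOn_of_mem_maximalAtlas c.dom_mem).mdifferentiableOn (by simp),
    (contMDiffOn_symm_of_mem_maximalAtlas c.dom_mem).mdifferentiableOn (by simp)⟩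

theorem contMDiffOn_cod_incl :
    ContMDiffOn 𝓘(ℝ, W) 𝓘(ℝ, V) ∞ (fun x => c.cod (S.incl x)) c.dom.source :=
  (contMDiffOn_of_mem_maximalAtlas c.cod_mem).comp S.isSmoothEmbedding.contMDiff.contMDiffOn
    c.source_subset

theorem coord_lift [IsManifold 𝓘(ℝ, V) ∞ N] {x : M} (hx : x ∈ c.dom.source)
    (u : NormalModel V W) : c.coord x (c.lift x u) = u := by
  have h := c.cod_mdiff.comp_symm_deriv (c.cod.map_source (c.source_subset hx))
  rw [c.cod.left_inv (c.source_subset hx)] at h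
  have h' := congrArg (fun T => T (c.split (0, u))) h
  change (c.split.symm (mfderiv 𝓘(ℝ, V) 𝓘(ℝ, V) c.cod (S.incl x)
    (mfderiv 𝓘(ℝ, V) 𝓘(ℝ, V) c.cod.symm (c.cod (S.incl x)) (c.split (0, u))))).2 = u
  have h'' : mfderiv 𝓘(ℝ, V) 𝓘(ℝ, V) c.cod (S.incl x)
    (mfderiv 𝓘(ℝ, V) 𝓘(ℝ, V) c.cod.symm (c.cod (S.incl x)) (c.split (0, u)))
      = c.split (0, u) := h'
  rw [h'']
  simp

variable [IsManifold 𝓘(ℝ, V) ∞ N] [IsManifold 𝓘(ℝ, W) ∞ M]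

theorem mfderiv_cod_dincl {x : M} (hx : x ∈ c.dom.source) (w : TangentSpace 𝓘(ℝ, W) x) :
    (mfderiv 𝓘(ℝ, V) 𝓘(ℝ, V) c.cod (S.incl x) (S.dincl x w) : V) =
      c.split ((mfderiv 𝓘(ℝ, W) 𝓘(ℝ, W) c.dom x w : W), 0) := by
  have hι : MDifferentiableAt 𝓘(ℝ, W) 𝓘(ℝ, V) S.incl x :=
    (S.isSmoothEmbedding.contMDiff x).mdifferentiableAt (by simp)
  have h1 : HasMFDerivAt 𝓘(ℝ, W) 𝓘(ℝ, V) (c.cod ∘ S.incl) x _ :=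
    (c.cod_mdiff.mdifferentiableAt (c.source_subset hx)).hasMFDerivAt.comp x hι.hasMFDerivAt
  let L : W →L[ℝ] V := (c.split : W × NormalModel V W →L[ℝ] V).comp
      (ContinuousLinearMap.inl ℝ W (NormalModel V W))
  have h2 : HasMFDerivAt 𝓘(ℝ, W) 𝓘(ℝ, V) (L ∘ c.dom) x _ :=
    (L.hasMFDerivAt (x := c.dom x)).comp x (c.dom_mdiff.mdifferentiableAt hx).hasMFDerivAt
  have h3 : (c.cod ∘ S.incl) =ᶠ[𝓝 x] (L ∘ c.dom) := by
    filter_upwards [c.dom.open_source.mem_nhds hx] with y hy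
    simpa [L] using c.cod_incl y hy
  have h4 := hasMFDerivAt_unique h1 (h2.congr_of_eventuallyEq h3)
  exact congrArg (fun T => T w) h4

theorem coord_eq_zero {x : M} (hx : x ∈ c.dom.source)
    (v : TangentSpace 𝓘(ℝ, V) (S.incl x)) :
    c.coord x v = 0 ↔ v ∈ (S.dincl x).range := by
  constructor
  · intro h
    obtain ⟨w, hw⟩ := c.dom_mdiff.mfderiv_surjective hx
      (c.split.symm (mfderiv 𝓘(ℝ, V) 𝓘(ℝ, V) c.cod (S.incl x) v)).1
    refine ⟨w, ?_⟩
    apply c.cod_mdiff.mfderiv_injective (c.source_subset hx)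
    refine (c.mfderiv_cod_dincl hx w).trans ?_
    rw [hw]
    apply c.split.symm.injective
    rw [ContinuousLinearEquiv.symm_apply_apply]
    exact Prod.ext rfl h.symm
  · rintro ⟨w, rfl⟩
    change (c.split.symm (mfderiv 𝓘(ℝ, V) 𝓘(ℝ, V) c.cod (S.incl x) (S.dincl x w))).2 = 0
    rw [c.mfderiv_cod_dincl hx w]
    simp

/-- The transverse coordinates on a fiber of the normal bundle. -/
def fiberEquiv {x : M} (hx : x ∈ c.dom.source) : S.NormalSpace x ≃ₗ[ℝ] NormalModel V W :=
  LinearEquiv.ofBijective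
    ((S.dincl x).range.liftQ (c.coord x).toLinearMap
      (fun v hv => (c.coord_eq_zero hx v).2 hv))
    ⟨by
      rw [← LinearMap.ker_eq_bot, LinearMap.ker_eq_bot']
      intro v hv
      obtain ⟨v, rfl⟩ := S.normalMk_surjective x v
      exact (S.normalMk_eq_zero x v).2 ((c.coord_eq_zero hx v).1 hv),
    fun u => ⟨S.normalMk x (c.lift x u), c.coord_lift hx u⟩⟩

theorem fiberEquiv_mk {x : M} (hx : x ∈ c.dom.source)
    (v : TangentSpace 𝓘(ℝ, V) (S.incl x)) :
    c.fiberEquiv hx (S.normalMk x v) = c.coord x v := rfl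

theorem fiberEquiv_symm {x : M} (hx : x ∈ c.dom.source) (u : NormalModel V W) :
    (c.fiberEquiv hx).symm u = S.normalMk x (c.lift x u) := by
  rw [LinearEquiv.symm_apply_eq, fiberEquiv_mk, c.coord_lift hx]

/-- `fiberEquiv` is a homeomorphism for the quotient topology. -/
def fiberCLE [FiniteDimensional ℝ V] {x : M} (hx : x ∈ c.dom.source) :
    S.NormalSpace x ≃L[ℝ] NormalModel V W where
  toLinearEquiv := c.fiberEquiv hx
  continuous_toFun := by
    refine continuous_quot_lift _ ?_
    exact (c.coord x).continuous
  continuous_invFun := by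
    have h : ((c.fiberEquiv hx).symm : NormalModel V W → S.NormalSpace x) =
        (fun v => (Submodule.Quotient.mk v : S.NormalSpace x)) ∘ c.lift x := by
      funext u
      exact c.fiberEquiv_symm hx u
    change Continuous ((c.fiberEquiv hx).symm : NormalModel V W → S.NormalSpace x)
    rw [h]
    exact continuous_quot_mk.comp (c.lift x).continuous

open Classical in
/-- The local trivialization of the normal bundle given by adapted coordinates. -/
def pretriv : Pretrivialization (NormalModel V W)
    (TotalSpace.proj : TotalSpace (NormalModel V W) S.NormalSpace → M) where
  toFun p := (p.1, if h : p.1 ∈ c.dom.source then c.fiberEquiv h p.2 else 0)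
  invFun q := ⟨q.1, if h : q.1 ∈ c.dom.source then (c.fiberEquiv h).symm q.2 else 0⟩
  source := TotalSpace.proj ⁻¹' c.dom.source
  target := c.dom.source ×ˢ Set.univ
  map_source' p hp := ⟨hp, trivial⟩
  map_target' q hq := hq.1
  left_inv' := by
    rintro ⟨x, v⟩ hx
    have hx' : x ∈ c.dom.source := hx
    simp [hx']
  right_inv' := by
    rintro ⟨x, v⟩ hx
    have hx' : x ∈ c.dom.source := hx.1
    simp [hx']
  open_target := c.dom.open_source.prod isOpen_univ
  baseSet := c.dom.source
  open_baseSet := c.dom.open_source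
  source_eq := rfl
  target_eq := rfl
  proj_toFun _ _ := rfl

theorem pretriv_apply {x : M} (hx : x ∈ c.dom.source) (v : S.NormalSpace x) :
    c.pretriv ⟨x, v⟩ = (x, c.fiberEquiv hx v) := by
  refine Prod.ext rfl ?_
  exact dif_pos hx

theorem pretriv_symm {x : M} (hx : x ∈ c.dom.source) (u : NormalModel V W) :
    c.pretriv.symm x u = (c.fiberEquiv hx).symm u := by
  have h1 := c.pretriv.mk_symm (b := x) hx u
  have h2 : c.pretriv.toPartialEquiv.symm (x, u) = ⟨x, (c.fiberEquiv hx).symm u⟩ := by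
    exact congrArg (TotalSpace.mk x) (dif_pos hx)
  have h3 := h1.trans h2
  simpa using h3

/-- The transition functions of the normal bundle. -/
def transition (c c' : S.AdaptedChart) (x : M) : NormalModel V W →L[ℝ] NormalModel V W :=
  ((ContinuousLinearMap.snd ℝ W (NormalModel V W)).comp
    (c'.split.symm : V →L[ℝ] W × NormalModel V W)).comp
  ((fderiv ℝ (c'.cod ∘ c.cod.symm) (c.cod (S.incl x))).comp
    ((c.split : W × NormalModel V W →L[ℝ] V).comp
      (ContinuousLinearMap.inr ℝ W (NormalModel V W))))

theorem contMDiffOn_transition (c c' : S.AdaptedChart) :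
    ContMDiffOn 𝓘(ℝ, W) 𝓘(ℝ, NormalModel V W →L[ℝ] NormalModel V W) ∞ (transition c c')
      (c.dom.source ∩ c'.dom.source) := by
  have hopen : IsOpen (c.cod.symm.trans c'.cod).source := (c.cod.symm.trans c'.cod).open_source
  have h1 : ContDiffOn ℝ ∞ (c'.cod ∘ c.cod.symm) (c.cod.symm.trans c'.cod).source := by
    rw [← contMDiffOn_iff_contDiffOn]
    refine (contMDiffOn_of_mem_maximalAtlas c'.cod_mem).comp
      ((contMDiffOn_symm_of_mem_maximalAtlas c.cod_mem).mono ?_) ?_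
    · intro y hy; exact hy.1
    · intro y hy; exact hy.2
  have h2 : ContDiffOn ℝ ∞ (fderiv ℝ (c'.cod ∘ c.cod.symm)) (c.cod.symm.trans c'.cod).source :=
    h1.fderiv_of_isOpen hopen (by simp)
  have h3 : ContDiffOn ℝ ∞ (fun y =>
      ((ContinuousLinearMap.snd ℝ W (NormalModel V W)).comp
        (c'.split.symm : V →L[ℝ] W × NormalModel V W)).comp
      ((fderiv ℝ (c'.cod ∘ c.cod.symm) y).comp
        ((c.split : W × NormalModel V W →L[ℝ] V).comp
          (ContinuousLinearMap.inr ℝ W (NormalModel V W)))))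
      (c.cod.symm.trans c'.cod).source :=
    contDiffOn_const.clm_comp (h2.clm_comp contDiffOn_const)
  refine h3.contMDiffOn.comp (c.contMDiffOn_cod_incl.mono Set.inter_subset_left) ?_
  rintro x ⟨hx, hx'⟩
  refine ⟨c.cod.map_source (c.source_subset hx), ?_⟩
  change c.cod.symm (c.cod (S.incl x)) ∈ c'.cod.source
  rw [c.cod.left_inv (c.source_subset hx)]
  exact c'.source_subset hx'

theorem hasMFDerivAt_symm {x : M} (hx : x ∈ c.dom.source) :
    HasMFDerivAt 𝓘(ℝ, V) 𝓘(ℝ, V) c.cod.symm (c.cod (S.incl x))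
      (mfderiv 𝓘(ℝ, V) 𝓘(ℝ, V) c.cod.symm (c.cod (S.incl x))) :=
  (c.cod_mdiff.symm.mdifferentiableAt
    (c.cod.map_source (c.source_subset hx) : c.cod (S.incl x) ∈ c.cod.symm.source)).hasMFDerivAt

theorem transition_apply (c c' : S.AdaptedChart) {x : M} (hx : x ∈ c.dom.source)
    (hx' : x ∈ c'.dom.source) (u : NormalModel V W) :
    transition c c' x u = (c'.pretriv ⟨x, c.pretriv.symm x u⟩).2 := by
  rw [c.pretriv_symm hx, c'.pretriv_apply hx', c.fiberEquiv_symm, c'.fiberEquiv_mk]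
  have hs := c.hasMFDerivAt_symm hx
  have hc := (c'.cod_mdiff.mdifferentiableAt (c'.source_subset hx')).hasMFDerivAt
  have hl : c.cod.symm (c.cod (S.incl x)) = S.incl x := c.cod.left_inv (c.source_subset hx)
  rw [← hl] at hc
  have h1 := hasMFDerivAt_iff_hasFDerivAt.1 (hc.comp _ hs)
  have h : fderiv ℝ (c'.cod ∘ c.cod.symm) (c.cod (S.incl x)) = _ := HasFDerivAt.fderiv h1
  rw [hl] at h
  have h' := congrArg (fun T : V →L[ℝ] V => (c'.split.symm (T (c.split (0, u)))).2) h
  exact h'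

/-- The normal bundle as a vector prebundle. -/
def _root_.EmbeddedSubmanifold.prebundle [FiniteDimensional ℝ V] [FiniteDimensional ℝ W]
    (S : EmbeddedSubmanifold V N W M) :
    VectorPrebundle ℝ (NormalModel V W) S.NormalSpace where
  pretrivializationAtlas := Set.range fun c : S.AdaptedChart => c.pretriv
  pretrivialization_linear' := by
    rintro _ ⟨c, rfl⟩
    refine ⟨fun x hx => ?_⟩
    have : (fun v : S.NormalSpace x => (c.pretriv ⟨x, v⟩).2) = c.fiberEquiv hx := by
      funext v; rw [c.pretriv_apply hx]
    rw [this]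
    exact (c.fiberEquiv hx).toLinearMap.isLinear
  pretrivializationAt x := (S.exists_adaptedChart x).choose.pretriv
  mem_base_pretrivializationAt x := (S.exists_adaptedChart x).choose_spec
  pretrivialization_mem_atlas x := ⟨_, rfl⟩
  exists_coordChange := by
    rintro _ ⟨c, rfl⟩ _ ⟨c', rfl⟩
    exact ⟨transition c c', (contMDiffOn_transition c c').continuousOn,
      fun x hx u => transition_apply c c' hx.1 hx.2 u⟩
  totalSpaceMk_isInducing x := by
    set c := (S.exists_adaptedChart x).choose with hcdef
    have hx : x ∈ c.dom.source := (S.exists_adaptedChart x).choose_spec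
    have h1 : (c.pretriv ∘ TotalSpace.mk x) = fun v => (x, c.fiberCLE hx v) := by
      funext v; exact c.pretriv_apply hx v
    rw [h1]
    exact Topology.isInducing_const_prod.2 (c.fiberCLE hx).toHomeomorph.isInducing

theorem isContMDiff_prebundle [FiniteDimensional ℝ V] [FiniteDimensional ℝ W]
    (S : EmbeddedSubmanifold V N W M) : S.prebundle.IsContMDiff 𝓘(ℝ, W) ∞ := by
  refine ⟨?_⟩
  rintro _ ⟨c, rfl⟩ _ ⟨c', rfl⟩
  exact ⟨transition c c', contMDiffOn_transition c c',
    fun x hx u => transition_apply c c' hx.1 hx.2 u⟩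

end AdaptedChart

variable [FiniteDimensional ℝ V] [FiniteDimensional ℝ W]
  [IsManifold 𝓘(ℝ, V) ∞ N] [IsManifold 𝓘(ℝ, W) ∞ M]

/-- The total space of the normal bundle `TN|_M / TM`. -/
abbrev NormalBundle (S : EmbeddedSubmanifold V N W M) : Type _ :=
  TotalSpace (NormalModel V W) S.NormalSpace

instance (S : EmbeddedSubmanifold V N W M) : TopologicalSpace S.NormalBundle :=
  S.prebundle.totalSpaceTopology

instance (S : EmbeddedSubmanifold V N W M) : FiberBundle (NormalModel V W) S.NormalSpace :=
  S.prebundle.toFiberBundle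

instance (S : EmbeddedSubmanifold V N W M) : VectorBundle ℝ (NormalModel V W) S.NormalSpace :=
  S.prebundle.toVectorBundle

instance (S : EmbeddedSubmanifold V N W M) :
    ContMDiffVectorBundle ∞ (NormalModel V W) S.NormalSpace 𝓘(ℝ, W) :=
  haveI := AdaptedChart.isContMDiff_prebundle S
  S.prebundle.contMDiffVectorBundle 𝓘(ℝ, W)

/-- The trivialization of the normal bundle given by adapted coordinates. -/
def AdaptedChart.triv {S : EmbeddedSubmanifold V N W M} (c : S.AdaptedChart) :
    Trivialization (NormalModel V W)
      (TotalSpace.proj : TotalSpace (NormalModel V W) S.NormalSpace → M) :=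
  S.prebundle.trivializationOfMemPretrivializationAtlas (e := c.pretriv) ⟨c, rfl⟩

instance {S : EmbeddedSubmanifold V N W M} (c : S.AdaptedChart) :
    MemTrivializationAtlas c.triv :=
  ⟨⟨c.pretriv, ⟨c, rfl⟩, rfl⟩⟩

theorem AdaptedChart.triv_apply {S : EmbeddedSubmanifold V N W M} (c : S.AdaptedChart) {x : M}
    (hx : x ∈ c.dom.source) (v : TangentSpace 𝓘(ℝ, V) (S.incl x)) :
    c.triv ⟨x, S.normalMk x v⟩ = (x, c.coord x v) :=
  c.pretriv_apply hx _

/-- The ideal of smooth functions on `N` that vanish on `M` (the linearizable functions). -/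
def vanishingIdeal (S : EmbeddedSubmanifold V N W M) : Ideal C^∞⟮𝓘(ℝ, V), N; ℝ⟯ where
  carrier := {F | ∀ x : M, F (S.incl x) = 0}
  add_mem' := by
    intro F G hF hG x
    change F (S.incl x) + G (S.incl x) = 0
    rw [hF x, hG x, add_zero]
  zero_mem' := fun _ => rfl
  smul_mem' := by
    intro F G hG x
    change F (S.incl x) * G (S.incl x) = 0
    rw [hG x, mul_zero]

theorem mfderiv_apply_of_mem (S : EmbeddedSubmanifold V N W M)
    {F : C^∞⟮𝓘(ℝ, V), N; ℝ⟯} (hF : F ∈ S.vanishingIdeal) (x : M)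
    (v : TangentSpace 𝓘(ℝ, V) (S.incl x)) (hv : v ∈ (S.dincl x).range) :
    mfderiv 𝓘(ℝ, V) 𝓘(ℝ, ℝ) F (S.incl x) v = 0 := by
  obtain ⟨w, rfl⟩ := hv
  have hι : MDifferentiableAt 𝓘(ℝ, W) 𝓘(ℝ, V) S.incl x :=
    (S.isSmoothEmbedding.contMDiff x).mdifferentiableAt (by simp)
  have hF' : MDifferentiableAt 𝓘(ℝ, V) 𝓘(ℝ, ℝ) F (S.incl x) :=
    (F.contMDiff (S.incl x)).mdifferentiableAt (by simp)
  have h1 := hF'.hasMFDerivAt.comp x hι.hasMFDerivAt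
  have h2 : (F ∘ S.incl) = fun _ => (0 : ℝ) := funext hF
  rw [h2] at h1
  have h3 := hasMFDerivAt_unique h1 (hasMFDerivAt_const (0 : ℝ) x)
  exact congrArg (fun T => T w) h3

/-- The linear functional on `T_xN / T_xM` induced by the differential of a function on `N`
that vanishes on `M`. -/
def conormal (S : EmbeddedSubmanifold V N W M) (F : S.vanishingIdeal) (x : M) :
    S.NormalSpace x →ₗ[ℝ] ℝ :=
  (S.dincl x).range.liftQ
    (mfderiv 𝓘(ℝ, V) 𝓘(ℝ, ℝ) (F : C^∞⟮𝓘(ℝ, V), N; ℝ⟯) (S.incl x)).toLinearMap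
    (fun v hv => S.mfderiv_apply_of_mem F.2 x v hv)

theorem conormal_mk (S : EmbeddedSubmanifold V N W M) (F : S.vanishingIdeal) (x : M)
    (v : TangentSpace 𝓘(ℝ, V) (S.incl x)) :
    S.conormal F x (S.normalMk x v) =
      mfderiv 𝓘(ℝ, V) 𝓘(ℝ, ℝ) (F : C^∞⟮𝓘(ℝ, V), N; ℝ⟯) (S.incl x) v := rfl

theorem conormal_eq (S : EmbeddedSubmanifold V N W M) (F : S.vanishingIdeal)
    (c : S.AdaptedChart) {x : M} (hx : x ∈ c.dom.source) (v : S.NormalSpace x) :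
    S.conormal F x v =
      fderiv ℝ ((F : C^∞⟮𝓘(ℝ, V), N; ℝ⟯) ∘ c.cod.symm) (c.cod (S.incl x))
        (c.split (0, (c.triv ⟨x, v⟩).2)) := by
  have hv : v = S.normalMk x (c.lift x (c.fiberEquiv hx v)) := by
    rw [← c.fiberEquiv_symm hx, LinearEquiv.symm_apply_apply]
  have ht : (c.triv ⟨x, v⟩).2 = c.fiberEquiv hx v := by
    obtain ⟨v, rfl⟩ := S.normalMk_surjective x v
    rw [c.triv_apply hx, c.fiberEquiv_mk]
  rw [ht]
  conv_lhs => rw [hv]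
  rw [conormal_mk]
  have hl : c.cod.symm (c.cod (S.incl x)) = S.incl x := c.cod.left_inv (c.source_subset hx)
  have hF : HasMFDerivAt 𝓘(ℝ, V) 𝓘(ℝ, ℝ) (F : C^∞⟮𝓘(ℝ, V), N; ℝ⟯) (S.incl x) _ :=
    (((F : C^∞⟮𝓘(ℝ, V), N; ℝ⟯).contMDiff (S.incl x)).mdifferentiableAt
      (by simp)).hasMFDerivAt
  rw [← hl] at hF
  have h1 := hasMFDerivAt_iff_hasFDerivAt.1 (hF.comp _ (c.hasMFDerivAt_symm hx))
  have h : fderiv ℝ ((F : C^∞⟮𝓘(ℝ, V), N; ℝ⟯) ∘ c.cod.symm) (c.cod (S.incl x)) = _ :=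
    HasFDerivAt.fderiv h1
  rw [hl] at h
  exact (congrArg (fun T : V →L[ℝ] ℝ => T (c.split (0, c.fiberEquiv hx v))) h).symm

/-- The linearization `F_lin` of a smooth function `F` on `N` that vanishes on `M`: the function
`(x, v mod T_xM) ↦ dF_x(v)` on the normal bundle. -/
def lin (S : EmbeddedSubmanifold V N W M) (F : S.vanishingIdeal) :
    C^∞⟮𝓘(ℝ, W).prod 𝓘(ℝ, NormalModel V W), S.NormalBundle; ℝ⟯ where
  val p := S.conormal F p.1 p.2
  property := by
    intro p₀
    obtain ⟨c, hc⟩ := S.exists_adaptedChart p₀.1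
    have hU : IsOpen c.triv.source := c.triv.open_source
    have hp : p₀ ∈ c.triv.source := c.triv.mem_source.2 hc
    have hG : ContDiffOn ℝ ∞ ((F : C^∞⟮𝓘(ℝ, V), N; ℝ⟯) ∘ c.cod.symm) c.cod.target := by
      rw [← contMDiffOn_iff_contDiffOn]
      exact (F : C^∞⟮𝓘(ℝ, V), N; ℝ⟯).contMDiff.comp_contMDiffOn
        (contMDiffOn_symm_of_mem_maximalAtlas c.cod_mem)
    have hG' : ContDiffOn ℝ ∞ (fderiv ℝ ((F : C^∞⟮𝓘(ℝ, V), N; ℝ⟯) ∘ c.cod.symm))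
        c.cod.target := hG.fderiv_of_isOpen c.cod.open_target (by simp)
    have hb : ContMDiffOn (𝓘(ℝ, W).prod 𝓘(ℝ, NormalModel V W)) 𝓘(ℝ, V) ∞
        (fun p : S.NormalBundle => c.cod (S.incl p.1)) c.triv.source :=
      c.contMDiffOn_cod_incl.comp (contMDiffOn_proj S.NormalSpace)
        (fun p hp => c.triv.mem_source.1 hp)
    have h1 : ContMDiffOn (𝓘(ℝ, W).prod 𝓘(ℝ, NormalModel V W)) 𝓘(ℝ, V →L[ℝ] ℝ) ∞
        (fun p : S.NormalBundle =>
          fderiv ℝ ((F : C^∞⟮𝓘(ℝ, V), N; ℝ⟯) ∘ c.cod.symm) (c.cod (S.incl p.1)))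
        c.triv.source :=
      hG'.contMDiffOn.comp hb
        (fun p hp => c.cod.map_source (c.source_subset (c.triv.mem_source.1 hp)))
    let L : NormalModel V W →L[ℝ] V := (c.split : W × NormalModel V W →L[ℝ] V).comp
      (ContinuousLinearMap.inr ℝ W (NormalModel V W))
    have h2 : ContMDiffOn (𝓘(ℝ, W).prod 𝓘(ℝ, NormalModel V W)) 𝓘(ℝ, V) ∞
        (fun p : S.NormalBundle => L (c.triv p).2) c.triv.source :=
      L.contMDiff.comp_contMDiffOn (contMDiff_snd.comp_contMDiffOn c.triv.contMDiffOn)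
    refine ((h1.clm_apply h2).congr ?_).contMDiffAt (hU.mem_nhds hp)
    rintro ⟨x, v⟩ hx
    exact S.conormal_eq F c (c.triv.mem_source.1 hx) v

theorem lin_apply (S : EmbeddedSubmanifold V N W M) (F : S.vanishingIdeal) (x : M)
    (v : TangentSpace 𝓘(ℝ, V) (S.incl x)) :
    S.lin F ⟨x, S.normalMk x v⟩ =
      mfderiv 𝓘(ℝ, V) 𝓘(ℝ, ℝ) (F : C^∞⟮𝓘(ℝ, V), N; ℝ⟯) (S.incl x) v := rfl

/-- A vector field `X` on `N` (a symmetric `1`-multivector) is tangent to `M` if its value at each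
point `x` of `M` is a tangent vector `w ∈ T_xM`. -/
def IsTangent (S : EmbeddedSubmanifold V N W M)
    (X : SymMultider C^∞⟮𝓘(ℝ, V), N; ℝ⟯ 1) : Prop :=
  ∀ x : M, ∃ w : TangentSpace 𝓘(ℝ, W) x, ∀ F : C^∞⟮𝓘(ℝ, V), N; ℝ⟯,
    X (fun _ => F) (S.incl x) = mfderiv 𝓘(ℝ, V) 𝓘(ℝ, ℝ) F (S.incl x) (S.dincl x w)

/-- The graded ideal `I_M` of the algebra of symmetric multivectors on `N` (with the symmetric
product) generated by the vector fields tangent to `M` and the functions vanishing on `M`: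
the smallest family closed under sums and under products with arbitrary symmetric multivectors.
In positive degrees the functions contribute nothing new, since `F • X` is tangent to `M` for every
vector field `X` if `F` vanishes on `M`. A symmetric multivector in `I_M` is called linearizable,
and `M` is then called coisotropic for it. -/
inductive IsLinearizable (S : EmbeddedSubmanifold V N W M) :
    ∀ {q : ℕ}, SymMultider C^∞⟮𝓘(ℝ, V), N; ℝ⟯ q → Prop
  | vectorField (X : SymMultider C^∞⟮𝓘(ℝ, V), N; ℝ⟯ 1) (hX : S.IsTangent X) : S.IsLinearizable X
  | function (F : C^∞⟮𝓘(ℝ, V), N; ℝ⟯) (hF : F ∈ S.vanishingIdeal) :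
      S.IsLinearizable (SymMultider.ofElem F)
  | zero (q : ℕ) : S.IsLinearizable (0 : SymMultider C^∞⟮𝓘(ℝ, V), N; ℝ⟯ q)
  | add {q : ℕ} (P Q : SymMultider C^∞⟮𝓘(ℝ, V), N; ℝ⟯ q) :
      S.IsLinearizable P → S.IsLinearizable Q → S.IsLinearizable (P + Q)
  | mul {p q : ℕ} (P : SymMultider C^∞⟮𝓘(ℝ, V), N; ℝ⟯ p)
      (Q : SymMultider C^∞⟮𝓘(ℝ, V), N; ℝ⟯ q) :
      S.IsLinearizable P → S.IsLinearizable (P.mul Q)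

end EmbeddedSubmanifold

/-! ## Fiberwise linear multivectors on a vector bundle -/

section FWL

variable {W : Type*} [NormedAddCommGroup W] [NormedSpace ℝ W]
  {M : Type*} [TopologicalSpace M] [ChartedSpace W M]
  (F : Type*) [NormedAddCommGroup F] [NormedSpace ℝ F]
  (E : M → Type*) [∀ x, AddCommGroup (E x)] [∀ x, Module ℝ (E x)]
  [∀ x, TopologicalSpace (E x)] [TopologicalSpace (TotalSpace F E)]
  [FiberBundle F E] [VectorBundle ℝ F E] [ContMDiffVectorBundle ∞ F E 𝓘(ℝ, W)]

/-- The fiberwise scalar multiplication `h_t : E → E` of a vector bundle. -/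
def fiberScale (t : ℝ) :
    C^∞⟮𝓘(ℝ, W).prod 𝓘(ℝ, F), TotalSpace F E; 𝓘(ℝ, W).prod 𝓘(ℝ, F), TotalSpace F E⟯ where
  val p := ⟨p.1, t • p.2⟩
  property := by
    intro p₀
    rw [contMDiffAt_totalSpace]
    refine ⟨contMDiffAt_proj E, ?_⟩
    have h0 : p₀ ∈ (trivializationAt F E p₀.1).source :=
      FiberBundle.mem_trivializationAt_proj_source
    have h1 : ContMDiffAt (𝓘(ℝ, W).prod 𝓘(ℝ, F)) 𝓘(ℝ, F) ∞
        (fun p : TotalSpace F E => t • (trivializationAt F E p₀.1 p).2) p₀ :=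
      (t • ContinuousLinearMap.id ℝ F).contMDiff.contMDiffAt.comp p₀
        (contMDiff_snd.contMDiffAt.comp p₀
          ((trivializationAt F E p₀.1).contMDiffOn.contMDiffAt
            ((trivializationAt F E p₀.1).open_source.mem_nhds h0)))
    refine h1.congr_of_eventuallyEq ?_
    filter_upwards [(trivializationAt F E p₀.1).open_source.mem_nhds h0] with p hp
    exact ((trivializationAt F E p₀.1).linear ℝ
      ((trivializationAt F E p₀.1).mem_source.1 hp)).map_smul t p.2

/-- A symmetric `q`-multivector `P` on the total space of a vector bundle is fiberwise linear if
`h_t^* P = t^(1 - q) P` for all `t ≠ 0`, where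
`(h_t^* P)(f₁, …, f_q) = h_t^* (P ((h_t⁻¹)^* f₁, …, (h_t⁻¹)^* f_q))`. -/
def IsFWL {q : ℕ}
    (P : SymMultider C^∞⟮𝓘(ℝ, W).prod 𝓘(ℝ, F), TotalSpace F E; ℝ⟯ q) : Prop :=
  ∀ t : ℝ, t ≠ 0 → ∀ f : Fin q → C^∞⟮𝓘(ℝ, W).prod 𝓘(ℝ, F), TotalSpace F E; ℝ⟯,
    (P fun i => (f i).comp (fiberScale F E t⁻¹)).comp (fiberScale F E t) =
      t ^ (1 - (q : ℤ)) • P f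

end FWL

namespace EmbeddedSubmanifold

variable {V : Type*} [NormedAddCommGroup V] [NormedSpace ℝ V] [FiniteDimensional ℝ V]
  {N : Type*} [TopologicalSpace N] [ChartedSpace V N] [IsManifold 𝓘(ℝ, V) ∞ N]
  {W : Type*} [NormedAddCommGroup W] [NormedSpace ℝ W] [FiniteDimensional ℝ W]
  {M : Type*} [TopologicalSpace M] [ChartedSpace W M] [IsManifold 𝓘(ℝ, W) ∞ M]

/-- The algebra of smooth functions on the normal bundle. -/
abbrev NormalFun (S : EmbeddedSubmanifold V N W M) : Type _ :=
  C^∞⟮𝓘(ℝ, W).prod 𝓘(ℝ, NormalModel V W), S.NormalBundle; ℝ⟯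

/-- `R` is a linearization of `P`: it is a fiberwise linear symmetric multivector on the normal
bundle, and, for all functions `F₁, …, F_q` on `N` vanishing on `M`, the function `P(F₁, …, F_q)`
vanishes on `M` as well and `R((F₁)_lin, …, (F_q)_lin) = P(F₁, …, F_q)_lin`. -/
def IsLinearizationOf (S : EmbeddedSubmanifold V N W M) {q : ℕ}
    (R : SymMultider S.NormalFun q) (P : SymMultider C^∞⟮𝓘(ℝ, V), N; ℝ⟯ q) : Prop :=
  IsFWL (NormalModel V W) S.NormalSpace R ∧
    ∀ F : Fin q → S.vanishingIdeal, ∃ h : P (fun i => (F i).1) ∈ S.vanishingIdeal,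
      R (fun i => S.lin (F i)) = S.lin ⟨P (fun i => (F i).1), h⟩

end EmbeddedSubmanifold

end

/-! Write `E` for the normal bundle. A multiderivation evaluated at a point is a point derivation in
each slot, and it is fixed by its values on coordinate functions. Both uniqueness and existence of
`P_lin` propagate identities from coordinates to all functions, one slot at a time
(`forall_of_forall_update`).

Uniqueness (`eq_of_lin_eq`). For a point `e` of `E` off the zero section some `lin η` is nonzero at
`e`. Since `lin (ξ • η) = pullback ξ * lin η`, a point derivation at `e` that kills every
linearization also kills pullbacks from `M`, hence everything. In positive codimension the zero
section has dense complement, so continuity extends the equality to all of `E`. The argument is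
local and so compares germs as well.

Existence (`PreservesIdeal.exists_lin`). The only consequence of linearizability needed here is that
`P` maps tuples of functions vanishing on `M` to such functions (`PreservesIdeal`). In adapted
coordinates the coefficient of `P_lin` at a multi-index is the linearization of the coefficient of
`P` if all indices are transverse to `M`, its restriction to `M` if exactly one index is along `M`,
and zero otherwise. Hadamard's lemma writes a function vanishing on `M` locally as a combination of
the transverse coordinates. This carries the defining identity from coordinates to all linearizable
functions (`IsFrameAt.apply_eq_zero`, `IsFrameAt.apply_pullback`, `IsFrameAt.apply_lin`). Local
solutions have equal germs by uniqueness, hence glue without a partition of unity. Fiberwise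
linearity is again uniqueness, since rescaling a solution gives a solution (`isFWL_of_lin`).

Brackets. Each term of `{P, Q}` on vanishing functions applies `Q` and then `P` to vanishing
functions, or the reverse, so the intertwining relation with `lin` passes to the bracket
(`PreservesIdeal.bracket_lin`). That `{P, Q}` stays in the ideal is algebra: the Leibniz rule
`eval_bracket_mul` reduces to brackets of generators. These have degree at most one, where
`PreservesIdeal` implies linearizability (`PreservesIdeal.isLinearizable_of_le_one`). For the
algebra, sums over unshuffles are rewritten as sums over splittings of multisets, which removes all
index bookkeeping. -/

set_option linter.unusedSectionVars false

noncomputable section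

/-! ## Sums over the splittings of a multiset -/

/-- The sum of `G t u` over all splittings `s = t + u` of a multiset (with multiplicity). -/
def splitSum {α B : Type*} [AddCommMonoid B] (G : Multiset α → Multiset α → B) (s : Multiset α) :
    B :=
  (s.antidiagonal.map fun p => G p.1 p.2).sum

section splitSum

variable {α B : Type*} [AddCommMonoid B]

theorem splitSum_zero (G : Multiset α → Multiset α → B) : splitSum G 0 = G 0 0 := by
  simp [splitSum]

theorem splitSum_cons (G : Multiset α → Multiset α → B) (a : α) (s : Multiset α) :
    splitSum G (a ::ₘ s) =
      splitSum (fun t u => G t (a ::ₘ u)) s + splitSum (fun t u => G (a ::ₘ t) u) s := by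
  simp [splitSum, Multiset.map_map]

theorem splitSum_add (G G' : Multiset α → Multiset α → B) (s : Multiset α) :
    splitSum (fun t u => G t u + G' t u) s = splitSum G s + splitSum G' s := by
  simp [splitSum]

theorem splitSum_congr {G G' : Multiset α → Multiset α → B} {s : Multiset α}
    (h : ∀ t u, t + u = s → G t u = G' t u) : splitSum G s = splitSum G' s := by
  unfold splitSum
  congr 1
  exact Multiset.map_congr rfl fun p hp => h _ _ (Multiset.mem_antidiagonal.1 hp)

theorem splitSum_eq_zero {G : Multiset α → Multiset α → B} {s : Multiset α}
    (h : ∀ t u, t + u = s → G t u = 0) : splitSum G s = 0 := by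
  rw [splitSum_congr h]
  simp [splitSum]

theorem splitSum_swap (G : Multiset α → Multiset α → B) (s : Multiset α) :
    splitSum (fun t u => G u t) s = splitSum G s := by
  unfold splitSum
  conv_rhs => rw [← Multiset.map_swap_antidiagonal, Multiset.map_map]
  rfl

/-- Coassociativity: both sides run over all splittings of `s` into three parts. It replaces any
reindexing of iterated unshuffles. -/
theorem splitSum_assoc (F : Multiset α → Multiset α → Multiset α → B) (s : Multiset α) :
    splitSum (fun t u => splitSum (fun t₁ t₂ => F t₁ t₂ u) t) s =
      splitSum (fun t₁ v => splitSum (fun t₂ u => F t₁ t₂ u) v) s := by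
  induction s using Multiset.induction_on generalizing F with
  | empty => simp only [splitSum_zero]
  | cons a s ih =>
    simp only [splitSum_cons, splitSum_add, ih]
    rw [add_assoc]

theorem splitSum_mul {R : Type*} [NonUnitalNonAssocSemiring R] (G : Multiset α → Multiset α → R)
    (s : Multiset α) (c : R) : splitSum G s * c = splitSum (fun t u => G t u * c) s := by
  simp [splitSum, Multiset.sum_map_mul_right]

theorem mul_splitSum {R : Type*} [NonUnitalNonAssocSemiring R] (G : Multiset α → Multiset α → R)
    (s : Multiset α) (c : R) : c * splitSum G s = splitSum (fun t u => c * G t u) s := by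
  simp [splitSum, Multiset.sum_map_mul_left]

theorem map_splitSum {C : Type*} [AddCommMonoid C] (φ : B →+ C)
    (G : Multiset α → Multiset α → B) (s : Multiset α) :
    φ (splitSum G s) = splitSum (fun t u => φ (G t u)) s := by
  simp [splitSum, map_multiset_sum, Multiset.map_map]

theorem splitSum_map {β : Type*} (φ : β → α) (G : Multiset α → Multiset α → B) (s : Multiset β) :
    splitSum G (s.map φ) = splitSum (fun t u => G (t.map φ) (u.map φ)) s := by
  induction s using Multiset.induction_on generalizing G with
  | empty => simp only [splitSum_zero, Multiset.map_zero]
  | cons a s ih => simp only [splitSum_cons, ih, Multiset.map_cons]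

/-- Repeated values among the `f i` do no harm: `antidiagonal` counts splittings with multiplicity,
exactly as subsets of the index set do. -/
theorem sum_powerset_eq_splitSum {ι : Type*} [DecidableEq ι] (f : ι → α)
    (G : Multiset α → Multiset α → B) (T : Finset ι) :
    ∑ S ∈ T.powerset, G (S.val.map f) ((T \ S).val.map f) = splitSum G (T.val.map f) := by
  induction T using Finset.induction_on generalizing G with
  | empty => simp [splitSum_zero]
  | insert a T ha ih =>
    rw [Finset.sum_powerset_insert ha, Finset.insert_val_of_notMem ha, Multiset.map_cons,
      splitSum_cons, ← ih, ← ih]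
    congr 1
    · refine Finset.sum_congr rfl fun S hS => ?_
      have haS : a ∉ S := fun h => ha (Finset.mem_powerset.1 hS h)
      have haT : a ∉ T \ S := fun h => ha (Finset.mem_sdiff.1 h).1
      rw [Finset.insert_sdiff_of_notMem _ haS, Finset.insert_val_of_notMem haT, Multiset.map_cons]
    · refine Finset.sum_congr rfl fun S hS => ?_
      have haS : a ∉ S := fun h => ha (Finset.mem_powerset.1 hS h)
      rw [Finset.insert_sdiff_insert, Finset.sdiff_insert_of_notMem ha,
        Finset.insert_val_of_notMem haS, Multiset.map_cons]

end splitSum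

/-! ### Products and brackets on multisets of arguments, and the Leibniz rule. -/

namespace SymMultider

variable {A : Type*} [CommRing A] [Algebra ℝ A]

theorem exists_eq_map_univ {A : Type*} {q : ℕ} {s : Multiset A} (h : s.card = q) :
    ∃ f : Fin q → A, s = Finset.univ.val.map f := by
  subst h
  obtain ⟨l, rfl⟩ := Quot.exists_rep s
  exact ⟨fun i => l.get i, by rw [Fin.univ_val_map]; simp⟩

theorem eval_ext {q : ℕ} {P Q : SymMultider A q} (h : ∀ s, P.eval s = Q.eval s) : P = Q := by
  ext f
  rw [← eval_map_univ, h, eval_map_univ]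

theorem eval_zero_apply {q : ℕ} (s : Multiset A) : (0 : SymMultider A q).eval s = 0 := by
  unfold eval
  split_ifs <;> rfl

theorem eval_add_apply {q : ℕ} (P Q : SymMultider A q) (s : Multiset A) :
    (P + Q).eval s = P.eval s + Q.eval s := by
  unfold eval
  split_ifs
  · rfl
  · simp

theorem eval_cons_zero {q : ℕ} (P : SymMultider A q) (s : Multiset A) :
    P.eval (0 ::ₘ s) = 0 := by
  simpa using P.eval_cons_smul s 0 0

/-- Evaluation in one argument, as an additive map. -/
def evalConsHom {q : ℕ} (P : SymMultider A q) (s : Multiset A) : A →+ A where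
  toFun a := P.eval (a ::ₘ s)
  map_zero' := P.eval_cons_zero s
  map_add' := P.eval_cons_add s

theorem eval_cons_splitSum {α : Type*} {q : ℕ} (P : SymMultider A q) (s : Multiset A)
    (G : Multiset α → Multiset α → A) (r : Multiset α) :
    P.eval (splitSum G r ::ₘ s) = splitSum (fun t u => P.eval (G t u ::ₘ s)) r :=
  map_splitSum (P.evalConsHom s) G r

/-- The cardinality condition on `S` can be dropped because the summand vanishes on parts of the
wrong size. `eval` returns zero there by convention, so degrees disappear from the later identities.
-/
theorem sum_powersetCard_args {A B : Type*} [AddCommMonoid B] {n k : ℕ} (f : Fin n → A)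
    (G : Multiset A → Multiset A → B) (hG : ∀ t u, t.card ≠ k → G t u = 0) :
    ∑ S ∈ Finset.powersetCard k Finset.univ, G (args f S) (args f Sᶜ) =
      splitSum G (Finset.univ.val.map f) := by
  rw [← sum_powerset_eq_splitSum]
  simp only [← Finset.compl_eq_univ_sdiff]
  refine Finset.sum_subset (fun S _ => by simp) fun S _ hS => hG _ _ ?_
  simpa [args, Finset.mem_powersetCard] using hS

theorem eval_mul {p q : ℕ} (P : SymMultider A p) (Q : SymMultider A q) (s : Multiset A) :
    (P.mul Q).eval s = splitSum (fun t u => P.eval t * Q.eval u) s := by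
  by_cases h : s.card = p + q
  · obtain ⟨f, rfl⟩ := exists_eq_map_univ h
    rw [eval_map_univ, mul_apply, sum_powersetCard_args f (fun t u => P.eval t * Q.eval u)]
    intro t u ht
    rw [P.eval_of_card_ne ht, zero_mul]
  · rw [eval_of_card_ne _ h, splitSum_eq_zero]
    rintro t u rfl
    by_cases ht : t.card = p
    · rw [Q.eval_of_card_ne (by rintro rfl; simp [ht] at h), mul_zero]
    · rw [P.eval_of_card_ne ht, zero_mul]

/-- The insertion of `Q` into `P`, on multisets. -/
def ins {p q : ℕ} (P : SymMultider A p) (Q : SymMultider A q) (s : Multiset A) : A :=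
  splitSum (fun t u => P.eval (Q.eval t ::ₘ u)) s

theorem insertion_eq_ins {p q n : ℕ} (P : SymMultider A p) (Q : SymMultider A q) (f : Fin n → A) :
    P.insertion Q f = P.ins Q (Finset.univ.val.map f) :=
  sum_powersetCard_args f (fun t u => P.eval (Q.eval t ::ₘ u)) fun t u ht => by
    rw [Q.eval_of_card_ne ht, eval_cons_zero]

theorem ins_of_card_ne {p q : ℕ} (P : SymMultider A p) (Q : SymMultider A q) {s : Multiset A}
    (h : s.card + 1 ≠ p + q) : P.ins Q s = 0 := by
  refine splitSum_eq_zero ?_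
  rintro t u rfl
  by_cases ht : t.card = q
  · refine P.eval_of_card_ne ?_
    rintro rfl
    apply h
    simp [ht]
    omega
  · rw [Q.eval_of_card_ne ht, eval_cons_zero]

theorem eval_bracket {p q n : ℕ} (h : p + q = n + 1) (P : SymMultider A p) (Q : SymMultider A q)
    (s : Multiset A) : (bracket h P Q).eval s = P.ins Q s - Q.ins P s := by
  by_cases hs : s.card = n
  · obtain ⟨f, rfl⟩ := exists_eq_map_univ hs
    rw [eval_map_univ, bracket_apply, insertion_eq_ins, insertion_eq_ins]
  · rw [eval_of_card_ne _ hs, ins_of_card_ne P Q (by omega), ins_of_card_ne Q P (by omega),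
      sub_zero]

/-- An inserted value `Q(t)` becomes an argument of exactly one of the two factors of the product.
The rest is a regrouping of three-part splittings. -/
theorem mul_ins {p₁ p₂ q : ℕ} (P₁ : SymMultider A p₁) (P₂ : SymMultider A p₂)
    (Q : SymMultider A q) (s : Multiset A) :
    (P₁.mul P₂).ins Q s =
      splitSum (fun t u => P₁.ins Q t * P₂.eval u) s +
        splitSum (fun t u => P₁.eval t * P₂.ins Q u) s := by
  simp only [ins, eval_mul, splitSum_cons, splitSum_mul, mul_splitSum, splitSum_add]
  rw [splitSum_assoc (fun t₁ t₂ u => P₁.eval (Q.eval t₁ ::ₘ t₂) * P₂.eval u), add_comm]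
  congr 1
  rw [← splitSum_assoc (fun t₁ t₂ u => P₁.eval t₂ * P₂.eval (Q.eval t₁ ::ₘ u)),
    ← splitSum_assoc (fun t₁ t₂ u => P₁.eval t₁ * P₂.eval (Q.eval t₂ ::ₘ u))]
  refine splitSum_congr fun t u _ => ?_
  exact splitSum_swap (fun t₂ t₁ => P₁.eval t₂ * P₂.eval (Q.eval t₁ ::ₘ u)) t

/-- This holds because `Q` is a derivation in the slot that receives the product. -/
theorem ins_mul {p₁ p₂ q : ℕ} (P₁ : SymMultider A p₁) (P₂ : SymMultider A p₂)
    (Q : SymMultider A q) (s : Multiset A) :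
    Q.ins (P₁.mul P₂) s =
      splitSum (fun t u => Q.ins P₁ t * P₂.eval u) s +
        splitSum (fun t u => P₁.eval t * Q.ins P₂ u) s := by
  simp only [ins, eval_mul, eval_cons_splitSum, eval_cons_mul, splitSum_add, splitSum_mul,
    mul_splitSum]
  rw [add_comm]
  congr 1
  · rw [splitSum_assoc (fun t₁ t₂ u => P₂.eval t₂ * Q.eval (P₁.eval t₁ ::ₘ u)),
      splitSum_assoc (fun t₁ t₂ u => Q.eval (P₁.eval t₁ ::ₘ t₂) * P₂.eval u)]
    refine splitSum_congr fun t u _ => ?_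
    rw [← splitSum_swap]
    simp only [mul_comm]
  · exact splitSum_assoc (fun t₁ t₂ u => P₁.eval t₁ * Q.eval (P₂.eval t₂ ::ₘ u)) s

/-- The graded Leibniz rule for the bracket, in terms of insertions. -/
theorem eval_bracket_mul {p₁ p₂ q n : ℕ} (h : p₁ + p₂ + q = n + 1) (P₁ : SymMultider A p₁)
    (P₂ : SymMultider A p₂) (Q : SymMultider A q) (s : Multiset A) :
    (bracket h (P₁.mul P₂) Q).eval s =
      splitSum (fun t u => (P₁.ins Q t - Q.ins P₁ t) * P₂.eval u) s +
        splitSum (fun t u => P₁.eval t * (P₂.ins Q u - Q.ins P₂ u)) s := by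
  have hsub : ∀ G G' : Multiset A → Multiset A → A,
      splitSum (fun t u => G t u - G' t u) s = splitSum G s - splitSum G' s := fun G G' => by
    rw [eq_sub_iff_add_eq, ← splitSum_add]
    simp
  rw [eval_bracket, mul_ins, ins_mul]
  simp only [sub_mul, mul_sub, hsub]
  ring

theorem ins_add {p q : ℕ} (P : SymMultider A p) (Q Q' : SymMultider A q) (s : Multiset A) :
    P.ins (Q + Q') s = P.ins Q s + P.ins Q' s := by
  simp only [ins, eval_add_apply, eval_cons_add, splitSum_add]

theorem add_ins {p q : ℕ} (P P' : SymMultider A p) (Q : SymMultider A q) (s : Multiset A) :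
    (P + P').ins Q s = P.ins Q s + P'.ins Q s := by
  simp only [ins, eval_add_apply, splitSum_add]

theorem bracket_add_left {p q n : ℕ} (h : p + q = n + 1) (P P' : SymMultider A p)
    (Q : SymMultider A q) : bracket h (P + P') Q = bracket h P Q + bracket h P' Q := by
  refine eval_ext fun s => ?_
  simp only [eval_add_apply, eval_bracket, ins_add, add_ins]
  ring

theorem zero_bracket {p q n : ℕ} (h : p + q = n + 1) (Q : SymMultider A q) :
    bracket h (0 : SymMultider A p) Q = 0 := by
  refine eval_ext fun s => ?_
  rw [eval_bracket, eval_zero_apply, ins, ins, splitSum_eq_zero, splitSum_eq_zero, sub_zero]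
  · intro t u _; rw [eval_zero_apply, eval_cons_zero]
  · intro t u _; rw [eval_zero_apply]

/-- The statement typechecks because `p + 0` reduces to `p`. Only the full index set contributes to
the product. -/
theorem mul_ofElem_apply {p : ℕ} (P : SymMultider A p) (a : A) (f : Fin p → A) :
    P.mul (ofElem a) f = P f * a := by
  have h : Finset.powersetCard p (Finset.univ : Finset (Fin p)) = {Finset.univ} := by
    simpa using Finset.powersetCard_self (Finset.univ : Finset (Fin p))
  refine (mul_apply P (ofElem a) f).trans ?_
  change ∑ S ∈ Finset.powersetCard p (Finset.univ : Finset (Fin p)), _ = _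
  rw [h, Finset.sum_singleton]
  congr 1
  · exact eval_map_univ P f
  · have h0 : args f (Finset.univ : Finset (Fin p))ᶜ =
        Finset.univ.val.map (fun i : Fin 0 => i.elim0) := by simp [args]
    exact (congrArg _ h0).trans (eval_map_univ (ofElem a) _)

/-- The sign is expressed as a product with the constant `-1`, so that antisymmetry stays within the
operations under which linearizable multivectors are closed. -/
theorem bracket_swap {p q n : ℕ} (h : p + q = n + 1) (P : SymMultider A p)
    (Q : SymMultider A q) :
    bracket h P Q = (bracket ((add_comm q p).trans h) Q P).mul (ofElem (-1)) := by
  ext f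
  rw [mul_ofElem_apply, bracket_apply, bracket_apply]
  ring

/-- The propagation principle behind uniqueness and local existence. The set of slots released from
the small class `C` to the large class `C'` grows by induction; `h` releases one slot while the
others are already allowed to be in `C'`. -/
theorem forall_of_forall_update {ι α : Type*} [DecidableEq ι] {Φ : (ι → α) → Prop}
    {C C' : ι → Set α} (hC : ∀ i, C i ⊆ C' i) [Finite ι]
    (h : ∀ f, (∀ j, f j ∈ C' j) → ∀ i, (∀ a ∈ C i, Φ (update f i a)) → Φ f)
    (h0 : ∀ f, (∀ j, f j ∈ C j) → Φ f) : ∀ f, (∀ j, f j ∈ C' j) → Φ f := by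
  cases nonempty_fintype ι
  suffices H : ∀ s : Finset ι, ∀ f, (∀ j ∈ s, f j ∈ C' j) → (∀ j ∉ s, f j ∈ C j) → Φ f from
    fun f hf => H Finset.univ f (fun j _ => hf j) (fun j hj => absurd (Finset.mem_univ j) hj)
  intro s
  induction s using Finset.induction_on with
  | empty => exact fun f _ hf => h0 f fun j => hf j (Finset.notMem_empty j)
  | insert i s hi ih =>
    intro f hf hf'
    have hall : ∀ j, f j ∈ C' j := fun j => by
      by_cases hj : j ∈ insert i s
      · exact hf j hj
      · exact hC j (hf' j hj)
    refine h f hall i fun a ha => ih _ (fun j hj => ?_) fun j hj => ?_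
    · rw [update_of_ne (by rintro rfl; exact hi hj)]
      exact hall j
    · by_cases hji : j = i
      · subst hji; rwa [update_self]
      · rw [update_of_ne hji]
        exact hf' j (by simp [hji, hj])

end SymMultider

/-! ## Hadamard's lemma -/

section Hadamard

universe u

/-- Differentiation under the integral sign, by induction on the order. The target `F` is
generalized because the derivative takes values in `E →L[ℝ] F`; sharing one universe keeps this
space in the range of the induction. -/
theorem contDiff_nat_intervalIntegral {E : Type u} [NormedAddCommGroup E] [NormedSpace ℝ E]
    [FiniteDimensional ℝ E] (n : ℕ) :
    ∀ {F : Type u} [NormedAddCommGroup F] [NormedSpace ℝ F] [CompleteSpace F]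
      {f : E × ℝ → F}, ContDiff ℝ n f → ContDiff ℝ n fun x => ∫ t in (0 : ℝ)..1, f (x, t) := by
  induction n with
  | zero =>
    intro F _ _ _ f hf
    rw [Nat.cast_zero, contDiff_zero] at hf ⊢
    exact intervalIntegral.continuous_parametric_intervalIntegral_of_continuous'
      (f := fun x t => f (x, t)) hf 0 1
  | succ n ih =>
    intro F _ _ _ f hf
    have hf1 : Differentiable ℝ f := hf.differentiable (by simp)
    let f' : E × ℝ → (E →L[ℝ] F) := fun z =>
      (fderiv ℝ f z).comp (ContinuousLinearMap.inl ℝ E ℝ)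
    have hf' : ContDiff ℝ n f' :=
      (hf.fderiv_right (m := n) (by simp)).clm_comp contDiff_const
    have hd : ∀ x t, HasFDerivAt (fun x => f (x, t)) (f' (x, t)) x := fun x t =>
      (hf1 (x, t)).hasFDerivAt.comp x (hasFDerivAt_prodMk_left x t)
    have key : ∀ x, HasFDerivAt (fun x => ∫ t in (0 : ℝ)..1, f (x, t))
        (∫ t in (0 : ℝ)..1, f' (x, t)) x := by
      intro x
      -- A constant dominates the derivative, by compactness of the unit ball around `x` times `[0,
      -- 1]`.
      obtain ⟨C, hC⟩ := ((isCompact_closedBall x 1).prod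
        (isCompact_Icc (a := (0 : ℝ)) (b := 1))).exists_bound_of_continuousOn
          hf'.continuous.continuousOn
      refine intervalIntegral.hasFDerivAt_integral_of_dominated_of_fderiv_le
        (F := fun x t => f (x, t)) (F' := fun x t => f' (x, t)) (bound := fun _ => C)
        (Metric.closedBall_mem_nhds x one_pos) ?_ ?_ ?_ ?_ ?_ ?_
      · exact Filter.Eventually.of_forall fun y =>
          (hf.continuous.comp (Continuous.prodMk_right y)).aestronglyMeasurable
      · exact (hf.continuous.comp (Continuous.prodMk_right x)).intervalIntegrable _ _
      · exact (hf'.continuous.comp (Continuous.prodMk_right x)).aestronglyMeasurable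
      · refine Filter.Eventually.of_forall fun t ht y hy => hC (y, t) ⟨hy, ?_⟩
        rw [Set.uIoc_of_le zero_le_one] at ht
        exact Set.Ioc_subset_Icc_self ht
      · exact intervalIntegrable_const
      · exact Filter.Eventually.of_forall fun t _ y _ => hd y t
    rw [Nat.cast_succ, contDiff_succ_iff_fderiv]
    refine ⟨fun x => (key x).differentiableAt, by simp, ?_⟩
    rw [show fderiv ℝ (fun x => ∫ t in (0 : ℝ)..1, f (x, t)) =
      fun x => ∫ t in (0 : ℝ)..1, f' (x, t) from funext fun x => (key x).fderiv]
    exact ih hf'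

/-- Hadamard's lemma, relative to a smooth map `r`. -/
theorem exists_contDiff_sub_eq {Z : Type*} [NormedAddCommGroup Z] [NormedSpace ℝ Z]
    [FiniteDimensional ℝ Z] {f : Z → ℝ} (hf : ContDiff ℝ ∞ f) {r : Z → Z}
    (hr : ContDiff ℝ ∞ r) :
    ∃ G : Z → Z →L[ℝ] ℝ, ContDiff ℝ ∞ G ∧ ∀ v, f v - f (r v) = G v (v - r v) := by
  have hc : ContDiff ℝ ∞ fun z : Z × ℝ => fderiv ℝ f (r z.1 + z.2 • (z.1 - r z.1)) := by
    refine (hf.fderiv_right (m := ∞) (by simp)).comp ?_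
    have h1 : ContDiff ℝ ∞ fun z : Z × ℝ => r z.1 := hr.comp contDiff_fst
    exact h1.add (contDiff_snd.smul (contDiff_fst.sub h1))
  -- `G v` averages the differential of `f` over the segment from `r v` to `v`; the identity is the
  -- fundamental theorem of calculus on that segment.
  refine ⟨fun v => ∫ t in (0 : ℝ)..1, fderiv ℝ f (r v + t • (v - r v)), ?_, fun v => ?_⟩
  · rw [contDiff_infty]
    exact fun n => contDiff_nat_intervalIntegral n (contDiff_infty.1 hc n)
  · have hcont : Continuous fun t : ℝ => fderiv ℝ f (r v + t • (v - r v)) :=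
      hc.continuous.comp (Continuous.prodMk_right v)
    rw [ContinuousLinearMap.intervalIntegral_apply (hcont.intervalIntegrable _ _)]
    have hd : ∀ t ∈ Set.uIcc (0 : ℝ) 1, HasDerivAt (fun t : ℝ => f (r v + t • (v - r v)))
        (fderiv ℝ f (r v + t • (v - r v)) (v - r v)) t := by
      intro t _
      have h1 : HasDerivAt (fun t : ℝ => r v + t • (v - r v)) (v - r v) t := by
        simpa using ((hasDerivAt_id t).smul_const (v - r v)).const_add (r v)
      exact ((hf.differentiable (by simp)) _).hasFDerivAt.comp_hasDerivAt t h1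
    rw [intervalIntegral.integral_eq_sub_of_hasDerivAt hd
      ((hcont.clm_apply continuous_const).intervalIntegrable _ _)]
    simp

end Hadamard

/-! ## Smooth coordinates and point derivations -/

section Coords

variable {E : Type*} [NormedAddCommGroup E] [NormedSpace ℝ E]
  {H : Type*} [TopologicalSpace H] {I : ModelWithCorners ℝ E H}
  {X : Type*} [TopologicalSpace X] [ChartedSpace H X]
  {Z : Type*} [NormedAddCommGroup Z] [NormedSpace ℝ Z]

theorem exists_bump [FiniteDimensional ℝ E] [IsManifold I ∞ X] [T2Space X] (p : X) {U : Set X}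
    (hU : U ∈ 𝓝 p) : ∃ χ : C^∞⟮I, X; ℝ⟯, tsupport χ ⊆ U ∧ ∀ᶠ x in 𝓝 p, χ x = 1 := by
  obtain ⟨f, _, hf⟩ := (SmoothBumpFunction.nhds_basis_tsupport (I := I) p).mem_iff.1 hU
  exact ⟨⟨f, f.contMDiff⟩, hf, f.eventuallyEq_one⟩

/-- A point derivation at `p` of the algebra of smooth functions. -/
def IsPointDer (p : X) (D : C^∞⟮I, X; ℝ⟯ → ℝ) : Prop :=
  IsLinearMap ℝ D ∧ ∀ a b, D (a * b) = a p * D b + b p * D a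

namespace IsPointDer

variable {p : X} {D : C^∞⟮I, X; ℝ⟯ → ℝ}

theorem map_one (hD : IsPointDer p D) : D 1 = 0 := by
  have h := hD.2 1 1
  have h1 : (1 : C^∞⟮I, X; ℝ⟯) p = 1 := rfl
  rw [mul_one, h1] at h
  linarith

theorem map_algebraMap (hD : IsPointDer p D) (c : ℝ) : D (algebraMap ℝ _ c) = 0 := by
  rw [Algebra.algebraMap_eq_smul_one, hD.1.map_smul, hD.map_one, smul_zero]

theorem map_sum (hD : IsPointDer p D) {κ : Type*} (s : Finset κ) (f : κ → C^∞⟮I, X; ℝ⟯) :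
    D (∑ k ∈ s, f k) = ∑ k ∈ s, D (f k) :=
  _root_.map_sum (hD.1.mk' D) f s

theorem sub {D' : C^∞⟮I, X; ℝ⟯ → ℝ} (hD : IsPointDer p D) (hD' : IsPointDer p D') :
    IsPointDer p fun f => D f - D' f := by
  refine ⟨⟨fun a b => ?_, fun c a => ?_⟩, fun a b => ?_⟩
  · simp only [hD.1.map_add, hD'.1.map_add]; ring
  · simp only [hD.1.map_smul, hD'.1.map_smul, smul_sub]
  · simp only [hD.2, hD'.2]; ring

variable [FiniteDimensional ℝ E] [IsManifold I ∞ X] [T2Space X]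

/-- Locality of point derivations: with a bump `χ` supported where `f = g`, the product `χ * (f -
g)` is zero, and the Leibniz rule at `p` leaves `D (f - g) = 0`. -/
theorem congr (hD : IsPointDer p D) {f g : C^∞⟮I, X; ℝ⟯} (h : ∀ᶠ x in 𝓝 p, f x = g x) :
    D f = D g := by
  obtain ⟨χ, hχ, hχ1⟩ := exists_bump (I := I) p h
  have h0 : χ * (f - g) = 0 := by
    ext x
    change χ x * (f x - g x) = 0
    by_cases hx : x ∈ tsupport χ
    · rw [hχ hx, sub_self, mul_zero]
    · rw [image_eq_zero_of_notMem_tsupport hx, zero_mul]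
  have h1 := hD.2 χ (f - g)
  have h2 : (f - g) p = 0 := sub_eq_zero.2 h.self_of_nhds
  rw [h0, h2, hχ1.self_of_nhds, hD.1.map_zero, hD.1.map_sub] at h1
  linarith

end IsPointDer

variable (I X Z) in
/-- Smooth coordinates on an open subset of a manifold. -/
structure SmoothCoords extends OpenPartialHomeomorph X Z where
  contMDiffOn_coe : ContMDiffOn I 𝓘(ℝ, Z) ∞ toFun source
  contMDiffOn_symm : ContMDiffOn 𝓘(ℝ, Z) I ∞ invFun target

namespace SmoothCoords

variable (φ : SmoothCoords I X Z)

instance : CoeFun (SmoothCoords I X Z) fun _ => X → Z :=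
  ⟨fun φ => φ.toOpenPartialHomeomorph⟩

theorem contDiffOn_comp_symm (f : C^∞⟮I, X; ℝ⟯) :
    ContDiffOn ℝ ∞ (fun z => f (φ.symm z)) φ.target :=
  contMDiffOn_iff_contDiffOn.1 (f.contMDiff.comp_contMDiffOn φ.contMDiffOn_symm)

/-- The cutoff `χ` is chosen before `g`, so a whole family of coordinate expressions can be extended
with the same `χ`. -/
theorem exists_extension [FiniteDimensional ℝ E] [IsManifold I ∞ X] [T2Space X] {p : X}
    (hp : p ∈ φ.source) : ∃ χ : C^∞⟮I, X; ℝ⟯, tsupport χ ⊆ φ.source ∧ (∀ᶠ x in 𝓝 p, χ x = 1) ∧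
      ∀ g : Z → ℝ, ContDiffOn ℝ ∞ g φ.target → ∃ g' : C^∞⟮I, X; ℝ⟯,
        ∀ x, g' x = χ x * g (φ x) := by
  obtain ⟨χ, hχ, hχ1⟩ := exists_bump (I := I) p (φ.open_source.mem_nhds hp)
  refine ⟨χ, hχ, hχ1, fun g hg => ⟨⟨fun x => χ x * g (φ x), contMDiff_of_tsupport fun x hx => ?_⟩,
    fun _ => rfl⟩⟩
  have hx' : x ∈ φ.source := hχ (tsupport_mul_subset_left hx)
  have h1 : ContMDiffOn I 𝓘(ℝ, ℝ) ∞ (fun x => g (φ x)) φ.source :=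
    hg.contMDiffOn.comp φ.contMDiffOn_coe fun y hy => φ.map_source hy
  exact (χ.contMDiff x).mul (h1.contMDiffAt (φ.open_source.mem_nhds hx'))

/-- Local form of Hadamard's lemma, relative to a smooth map `r` of the coordinate space. -/
theorem exists_local_hadamard [FiniteDimensional ℝ E] [FiniteDimensional ℝ Z] [IsManifold I ∞ X]
    [T2Space X] {p : X} (hp : p ∈ φ.source) (f : C^∞⟮I, X; ℝ⟯) {r : Z → Z}
    (hr : ContDiff ℝ ∞ r) {c : ℝ} (hc : ∀ z ∈ φ.target, r z ∈ φ.target → f (φ.symm (r z)) = c)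
    (hrp : r (φ p) = φ p) {κ : Type*} [Fintype κ] (B : Module.Basis κ ℝ Z) :
    ∃ g : κ → C^∞⟮I, X; ℝ⟯, ∀ᶠ x in 𝓝 p,
      f x = c + ∑ k, g k x * B.coord k (φ x - r (φ x)) := by
  -- A bump on the coordinate space makes `f ∘ φ⁻¹ - c` a smooth function on all of `Z`, to which
  -- the global Hadamard lemma applies. After `r` it vanishes near `φ p`, since `r` fixes `φ p`.
  obtain ⟨h, hh, hh1⟩ := exists_bump (I := 𝓘(ℝ, Z)) (φ p)
    (φ.open_target.mem_nhds (φ.map_source hp))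
  have hhs : ContDiff ℝ ∞ h := contMDiff_iff_contDiff.1 h.contMDiff
  have hF : ContDiff ℝ ∞ fun z => h z * (f (φ.symm z) - c) := by
    rw [← contMDiff_iff_contDiff]
    refine contMDiff_of_tsupport fun z hz => ?_
    have hz' : z ∈ φ.target := hh (tsupport_mul_subset_left hz)
    exact (h.contMDiff z).mul ((((φ.contDiffOn_comp_symm f).contDiffAt
      (φ.open_target.mem_nhds hz')).sub contDiffAt_const).contMDiffAt)
  obtain ⟨G, hG, hGr⟩ := exists_contDiff_sub_eq hF hr
  obtain ⟨χ, -, hχ1, hχ⟩ := φ.exists_extension hp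
  choose g hg using fun k => hχ (fun z => G z (B k))
    (hG.clm_apply contDiff_const).contDiffOn
  refine ⟨g, ?_⟩
  have hφ : Filter.Tendsto φ (𝓝 p) (𝓝 (φ p)) := φ.continuousAt hp
  have hrφ : Filter.Tendsto (fun x => r (φ x)) (𝓝 p) (𝓝 (φ p)) := by
    have := (hr.continuous.tendsto (φ p)).comp hφ
    rwa [hrp] at this
  filter_upwards [hχ1, hφ.eventually hh1, φ.open_source.mem_nhds hp,
    hrφ.eventually (φ.open_target.mem_nhds (φ.map_source hp))] with x h1 h2 h3 h4
  have h5 := hGr (φ x)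
  have h6 : f (φ.symm (φ x)) = f x := by rw [φ.left_inv h3]
  rw [hc _ (φ.map_source h3) h4, sub_self, mul_zero, sub_zero, h2, one_mul, h6] at h5
  rw [← sub_eq_iff_eq_add', h5]
  conv_lhs => rw [← B.sum_repr (φ x - r (φ x))]
  simp only [map_sum, map_smul, hg, h1, one_mul, smul_eq_mul, Module.Basis.coord_apply]
  exact Finset.sum_congr rfl fun k _ => mul_comm _ _

/-- Hadamard's lemma with the constant map `r = φ p` gives `f = f(p) + ∑ g_k (ζ_k - ζ_k(p))` near
`p`. The Leibniz rule then expresses `D f` through the `D ζ_k`. -/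
theorem eq_zero_of_coord_eq_zero [FiniteDimensional ℝ E] [FiniteDimensional ℝ Z]
    [IsManifold I ∞ X] [T2Space X] {p : X} (hp : p ∈ φ.source) {κ : Type*} [Fintype κ]
    (B : Module.Basis κ ℝ Z) (ζ : κ → C^∞⟮I, X; ℝ⟯)
    (hζ : ∀ k, ∀ᶠ x in 𝓝 p, ζ k x = B.coord k (φ x)) {D : C^∞⟮I, X; ℝ⟯ → ℝ}
    (hD : IsPointDer p D) (h0 : ∀ k, D (ζ k) = 0) (f : C^∞⟮I, X; ℝ⟯) : D f = 0 := by
  obtain ⟨g, hg⟩ := φ.exists_local_hadamard hp f (r := fun _ => φ p) contDiff_const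
    (c := f p) (fun _ _ _ => by rw [φ.left_inv hp]) rfl B
  have h1 : D f = D (algebraMap ℝ _ (f p) +
      ∑ k, g k * (ζ k - algebraMap ℝ C^∞⟮I, X; ℝ⟯ (ζ k p))) := by
    refine hD.congr ?_
    filter_upwards [hg, Filter.eventually_all.2 hζ] with x h2 h3
    rw [h2]
    have h4 : ∀ F : κ → C^∞⟮I, X; ℝ⟯, (∑ k, F k : C^∞⟮I, X; ℝ⟯) x = ∑ k, F k x := fun F =>
      map_sum (ContMDiffMap.evalRingHom (I := I) (n := ∞) (R := ℝ) x) F Finset.univ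
    change _ = f p + (∑ k, g k * (ζ k - algebraMap ℝ C^∞⟮I, X; ℝ⟯ (ζ k p)) : C^∞⟮I, X; ℝ⟯) x
    rw [h4]
    congr 1
    refine Finset.sum_congr rfl fun k _ => ?_
    change _ = g k x * (ζ k x - ζ k p)
    rw [h3 k, (hζ k).self_of_nhds, map_sub]
  rw [h1, hD.1.map_add, hD.map_algebraMap, hD.map_sum, zero_add]
  refine Finset.sum_eq_zero fun k _ => ?_
  have h5 : (ζ k - algebraMap ℝ C^∞⟮I, X; ℝ⟯ (ζ k p)) p = 0 := sub_self (ζ k p)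
  rw [hD.2, h5, hD.1.map_sub, h0, hD.map_algebraMap]
  simp

/-- Coordinate vector fields, multiplied by a cutoff function. -/
theorem exists_coord_derivations [FiniteDimensional ℝ E] [FiniteDimensional ℝ Z]
    [IsManifold I ∞ X] [T2Space X] {p : X} (hp : p ∈ φ.source) {κ : Type*} [Fintype κ]
    [DecidableEq κ] (B : Module.Basis κ ℝ Z) (ζ : κ → C^∞⟮I, X; ℝ⟯)
    (hζ : ∀ k, ∀ᶠ x in 𝓝 p, ζ k x = B.coord k (φ x)) :
    ∃ D : κ → Derivation ℝ C^∞⟮I, X; ℝ⟯ C^∞⟮I, X; ℝ⟯, ∀ᶠ x in 𝓝 p, ∀ k l,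
      D k (ζ l) x = if k = l then 1 else 0 := by
  obtain ⟨χ, hχs, hχ1, hχ⟩ := φ.exists_extension hp
  have hs : ∀ f : C^∞⟮I, X; ℝ⟯, ContDiffOn ℝ ∞ (fderiv ℝ fun z => f (φ.symm z)) φ.target :=
    fun f => (φ.contDiffOn_comp_symm f).fderiv_of_isOpen φ.open_target (by simp)
  have hd : ∀ (f : C^∞⟮I, X; ℝ⟯), ∀ x ∈ φ.source,
      DifferentiableAt ℝ (fun z => f (φ.symm z)) (φ x) := fun f x hx =>
    ((φ.contDiffOn_comp_symm f).contDiffAt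
      (φ.open_target.mem_nhds (φ.map_source hx))).differentiableAt (by simp)
  -- `d k f` is `χ` times the `k`-th partial derivative of `f` in the coordinates. The derivation
  -- identities only need checking on the chart domain, as `χ` vanishes elsewhere.
  choose d hd' using fun (k : κ) (f : C^∞⟮I, X; ℝ⟯) =>
    hχ (fun z => fderiv ℝ (fun z => f (φ.symm z)) z (B k)) ((hs f).clm_apply contDiffOn_const)
  have hχ0 : ∀ x ∉ φ.source, χ x = 0 := fun x hx =>
    image_eq_zero_of_notMem_tsupport fun h => hx (hχs h)
  let D : κ → Derivation ℝ C^∞⟮I, X; ℝ⟯ C^∞⟮I, X; ℝ⟯ := fun k => Derivation.mk'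
    { toFun := d k
      map_add' := fun f g => by
        ext x
        change d k (f + g) x = d k f x + d k g x
        simp only [hd']
        by_cases hx : x ∈ φ.source
        · have : fderiv ℝ (fun z => (f + g) (φ.symm z)) (φ x) = _ :=
            fderiv_add (hd f x hx) (hd g x hx)
          rw [this, add_apply, mul_add]
        · simp [hχ0 x hx]
      map_smul' := fun c f => by
        ext x
        change d k (c • f) x = c * d k f x
        simp only [hd']
        by_cases hx : x ∈ φ.source
        · have : fderiv ℝ (fun z => (c • f) (φ.symm z)) (φ x) = _ :=
            fderiv_const_smul (hd f x hx) c
          rw [this, smul_apply, smul_eq_mul, mul_left_comm]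
        · simp [hχ0 x hx] }
    (fun f g => by
      ext x
      change d k (f * g) x = f x * d k g x + g x * d k f x
      simp only [hd']
      by_cases hx : x ∈ φ.source
      · have : fderiv ℝ (fun z => (f * g) (φ.symm z)) (φ x) = _ :=
          fderiv_mul (hd f x hx) (hd g x hx)
        rw [this, add_apply, smul_apply,
          smul_apply, φ.left_inv hx, smul_eq_mul, smul_eq_mul]
        ring
      · simp [hχ0 x hx])
  refine ⟨D, ?_⟩
  filter_upwards [hχ1, φ.open_source.mem_nhds hp,
    (Filter.eventually_all.2 hζ).eventually_nhds] with x h1 hx h2 k l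
  change d k (ζ l) x = _
  rw [hd', h1, one_mul]
  let b : Z →L[ℝ] ℝ := LinearMap.toContinuousLinearMap (B.coord l)
  have h3 : (fun z => ζ l (φ.symm z)) =ᶠ[𝓝 (φ x)] b := by
    have hsymm : Filter.Tendsto φ.symm (𝓝 (φ x)) (𝓝 x) := by
      have := φ.symm.continuousAt (φ.map_source hx)
      rwa [ContinuousAt, φ.left_inv hx] at this
    filter_upwards [hsymm.eventually h2, φ.open_target.mem_nhds (φ.map_source hx)] with z hz hz'
    rw [hz l, φ.right_inv hz']
    rfl
  rw [h3.fderiv_eq, b.fderiv]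
  change B.coord l (B k) = _
  rw [Module.Basis.coord_apply, Module.Basis.repr_self, Finsupp.single_apply]

end SmoothCoords

end Coords

namespace EmbeddedSubmanifold

variable {V : Type*} [NormedAddCommGroup V] [NormedSpace ℝ V]
  {N : Type*} [TopologicalSpace N] [ChartedSpace V N]
  {W : Type*} [NormedAddCommGroup W] [NormedSpace ℝ W]
  {M : Type*} [TopologicalSpace M] [ChartedSpace W M]

/-! ## Coordinates on the ambient manifold and on the normal bundle -/

theorem AdaptedChart.split_symm_cod {S : EmbeddedSubmanifold V N W M} (c : S.AdaptedChart) {x : M}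
    (hx : x ∈ c.dom.source) : c.split.symm (c.cod (S.incl x)) = (c.dom x, 0) := by
  rw [c.cod_incl x hx, ContinuousLinearEquiv.symm_apply_apply]

/-- The coordinates on `N` given by an adapted chart, restricted to an open set that meets `M`
only in the domain of the chart of `M`. -/
theorem AdaptedChart.exists_ambientCoords {S : EmbeddedSubmanifold V N W M} (c : S.AdaptedChart) :
    ∃ φ : SmoothCoords 𝓘(ℝ, V) N (W × NormalModel V W),
      (∀ p, φ p = c.split.symm (c.cod p)) ∧
      (∀ x, S.incl x ∈ φ.source ↔ x ∈ c.dom.source) ∧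
      ∀ z ∈ φ.target, z.2 = 0 → ∃ x, S.incl x = φ.symm z := by
  -- The topology of `M` is induced from `N`, so some open `O` meets `M` exactly in the chart
  -- domain; this excludes other sheets of `M` from the chart.
  obtain ⟨O, hO, hOM⟩ := S.isSmoothEmbedding.isEmbedding.isInducing.isOpen_iff.1 c.dom.open_source
  let φ₀ : OpenPartialHomeomorph N (W × NormalModel V W) :=
    c.cod.transHomeomorph c.split.symm.toHomeomorph
  have hφ₀ : ∀ p, φ₀ p = c.split.symm (c.cod p) := fun _ => rfl
  -- Requiring the base coordinate to lie in the image of the chart of `M` ensures that every point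
  -- with zero transverse coordinate really lies on `M`.
  let s : Set N := (φ₀.source ∩ φ₀ ⁻¹' (Prod.fst ⁻¹' c.dom.target)) ∩ O
  have hs : IsOpen s :=
    (φ₀.isOpen_inter_preimage (c.dom.open_target.preimage continuous_fst)).inter hO
  let φ₁ := φ₀.restrOpen s hs
  have hsource : φ₁.source = c.cod.source ∩ s := φ₀.restrOpen_source s hs
  have hM : ∀ x, S.incl x ∈ φ₁.source ↔ x ∈ c.dom.source := by
    intro x
    rw [hsource]
    constructor
    · rintro ⟨_, _, hx⟩
      rw [← hOM]; exact hx
    · intro hx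
      refine ⟨c.source_subset hx, ⟨c.source_subset hx, ?_⟩, ?_⟩
      · change (c.split.symm (c.cod (S.incl x))).1 ∈ c.dom.target
        rw [c.split_symm_cod hx]
        exact c.dom.map_source hx
      · rw [← hOM] at hx; exact hx
  have htarget : ∀ z ∈ φ₁.target, c.split z ∈ c.cod.target := by
    intro z hz
    have := φ₁.map_target hz
    rw [hsource] at this
    have h1 := c.cod.map_source this.1
    have h2 : c.split.symm (c.cod (φ₁.symm z)) = z := φ₁.right_inv hz
    rwa [← h2, ContinuousLinearEquiv.apply_symm_apply]
  refine ⟨⟨φ₁, ?_, ?_⟩, hφ₀, hM, ?_⟩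
  · refine (c.split.symm : V →L[ℝ] W × NormalModel V W).contMDiff.comp_contMDiffOn
      ((contMDiffOn_of_mem_maximalAtlas c.cod_mem).mono ?_)
    rw [hsource]
    exact Set.inter_subset_left
  · exact (contMDiffOn_symm_of_mem_maximalAtlas c.cod_mem).comp
      (c.split : W × NormalModel V W →L[ℝ] V).contMDiff.contMDiffOn htarget
  · intro z hz hz0
    have h1 := φ₁.map_target hz
    rw [hsource] at h1
    have h2 : (φ₁ (φ₁.symm z)).1 ∈ c.dom.target := h1.2.1.2
    rw [φ₁.right_inv hz] at h2
    have hx := c.dom.map_target h2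
    refine ⟨c.dom.symm z.1, ?_⟩
    have h3 : φ₁ (S.incl (c.dom.symm z.1)) = z := by
      refine (c.split_symm_cod hx).trans ?_
      rw [c.dom.right_inv h2, ← hz0]
    change _ = φ₁.symm z
    exact ((congrArg φ₁.symm h3).symm.trans (φ₁.left_inv ((hM _).2 hx))).symm

variable [FiniteDimensional ℝ V] [FiniteDimensional ℝ W]
  [IsManifold 𝓘(ℝ, V) ∞ N] [IsManifold 𝓘(ℝ, W) ∞ M]

/-- The coordinates on the normal bundle given by an adapted chart. -/
theorem AdaptedChart.exists_normalCoords {S : EmbeddedSubmanifold V N W M} (c : S.AdaptedChart) :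
    ∃ φ : SmoothCoords (𝓘(ℝ, W).prod 𝓘(ℝ, NormalModel V W)) S.NormalBundle
        (W × NormalModel V W),
      (∀ e : S.NormalBundle, φ e = (c.dom e.1, (c.triv e).2)) ∧
      ∀ e : S.NormalBundle, e ∈ φ.source ↔ e.1 ∈ c.dom.source := by
  let φ₁ : OpenPartialHomeomorph S.NormalBundle (W × NormalModel V W) :=
    c.triv.toOpenPartialHomeomorph.trans
      (c.dom.prod (OpenPartialHomeomorph.refl (NormalModel V W)))
  have hs : ∀ e : S.NormalBundle, e ∈ φ₁.source ↔ e.1 ∈ c.dom.source := by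
    intro e
    have h1 : e ∈ c.triv.source ↔ e.1 ∈ c.dom.source := c.triv.mem_source
    constructor
    · rintro ⟨h, -⟩
      exact h1.1 h
    · intro h
      refine ⟨h1.2 h, ?_⟩
      change c.triv e ∈ c.dom.source ×ˢ Set.univ
      refine ⟨?_, trivial⟩
      rw [c.triv.coe_fst (h1.2 h)]
      exact h
  have hφ : ∀ e : S.NormalBundle, φ₁ e = (c.dom e.1, (c.triv e).2) := fun _ => rfl
  have hsub : φ₁.source ⊆ c.triv.source := fun e he => he.1
  refine ⟨⟨φ₁, ?_, ?_⟩, hφ, hs⟩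
  · refine ContMDiffOn.prodMk_space ?_ ?_
    · exact (contMDiffOn_of_mem_maximalAtlas c.dom_mem).comp (contMDiffOn_proj S.NormalSpace)
        fun e he => (hs e).1 he
    · exact contMDiff_snd.comp_contMDiffOn (c.triv.contMDiffOn.mono hsub)
  · refine c.triv.contMDiffOn_symm.comp ?_ fun z hz => hz.2
    refine ContMDiffOn.prodMk ?_ (contMDiff_iff_contDiff.2 contDiff_snd).contMDiffOn
    exact (contMDiffOn_symm_of_mem_maximalAtlas c.dom_mem).comp
      (contMDiff_iff_contDiff.2 contDiff_fst).contMDiffOn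
      fun z hz => hz.1.1

/-- Points of one fiber are separated in a trivialization, points of different fibers by their
projections to `M`. Bump functions on the normal bundle need this property. -/
theorem t2Space_normalBundle [T2Space N] (S : EmbeddedSubmanifold V N W M) :
    T2Space S.NormalBundle := by
  have : T2Space M := S.isSmoothEmbedding.isEmbedding.t2Space
  refine ⟨fun e e' hne => ?_⟩
  by_cases h : e.1 = e'.1
  · obtain ⟨c, hc⟩ := S.exists_adaptedChart e.1
    have he : e ∈ c.triv.source := c.triv.mem_source.2 hc
    have he' : e' ∈ c.triv.source := c.triv.mem_source.2 (show e'.1 ∈ _ from h ▸ hc)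
    have hne' : c.triv e ≠ c.triv e' := fun h' => hne (c.triv.injOn he he' h')
    obtain ⟨u, v, hu, hv, heu, hev, huv⟩ := t2_separation hne'
    exact ⟨_, _, c.triv.isOpen_inter_preimage hu, c.triv.isOpen_inter_preimage hv, ⟨he, heu⟩,
      ⟨he', hev⟩, Set.disjoint_left.2 fun a ha ha' => Set.disjoint_left.1 huv ha.2 ha'.2⟩
  · obtain ⟨u, v, hu, hv, heu, hev, huv⟩ := t2_separation h
    have hc : Continuous (TotalSpace.proj : S.NormalBundle → M) :=
      FiberBundle.continuous_proj _ _
    exact ⟨_, _, hu.preimage hc, hv.preimage hc, heu, hev, huv.preimage _⟩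

instance [T2Space N] (S : EmbeddedSubmanifold V N W M) : T2Space S.NormalBundle :=
  S.t2Space_normalBundle

/-- The pullback of a function on `N` to the normal bundle. -/
def pullback (S : EmbeddedSubmanifold V N W M) : C^∞⟮𝓘(ℝ, V), N; ℝ⟯ →ₐ[ℝ] S.NormalFun where
  toFun g := ⟨fun e => g (S.incl e.1),
    g.contMDiff.comp (S.isSmoothEmbedding.contMDiff.comp (contMDiff_proj S.NormalSpace))⟩
  map_one' := rfl
  map_mul' _ _ := rfl
  map_zero' := rfl
  map_add' _ _ := rfl
  commutes' _ := rfl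

theorem pullback_apply (S : EmbeddedSubmanifold V N W M) (g : C^∞⟮𝓘(ℝ, V), N; ℝ⟯)
    (e : S.NormalBundle) : S.pullback g e = g (S.incl e.1) := rfl

theorem pullback_eq_zero (S : EmbeddedSubmanifold V N W M) {g : C^∞⟮𝓘(ℝ, V), N; ℝ⟯}
    (hg : g ∈ S.vanishingIdeal) : S.pullback g = 0 := by
  ext e
  exact hg e.1

theorem mdifferentiableAt_smooth (g : C^∞⟮𝓘(ℝ, V), N; ℝ⟯) (p : N) :
    MDifferentiableAt 𝓘(ℝ, V) 𝓘(ℝ, ℝ) g p :=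
  (g.contMDiff p).mdifferentiableAt (by simp)

/-- The derivative of functions on `N` along a tangent vector. -/
def vectorDer (p : N) (v : TangentSpace 𝓘(ℝ, V) p) (f : C^∞⟮𝓘(ℝ, V), N; ℝ⟯) : ℝ :=
  mfderiv 𝓘(ℝ, V) 𝓘(ℝ, ℝ) f p v

theorem isPointDer_vectorDer (p : N) (v : TangentSpace 𝓘(ℝ, V) p) :
    IsPointDer p (vectorDer p v) := by
  refine ⟨⟨fun f g => ?_, fun c f => ?_⟩, fun f g => ?_⟩
  · have h := (mdifferentiableAt_smooth f p).hasMFDerivAt.add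
      (mdifferentiableAt_smooth g p).hasMFDerivAt
    exact congrArg (fun T => T v) h.mfderiv
  · have h := (mdifferentiableAt_smooth f p).hasMFDerivAt.const_smul c
    exact congrArg (fun T => T v) h.mfderiv
  · have h := (mdifferentiableAt_smooth f p).hasMFDerivAt.mul
      (mdifferentiableAt_smooth g p).hasMFDerivAt
    exact congrArg (fun T => T v) h.mfderiv

/-- The vector `v` represents the normal class `e` and is independent of `F`, so pointwise
identities for `lin` become identities for a single point derivation on `N`. -/
theorem exists_lin_eq_vectorDer (S : EmbeddedSubmanifold V N W M) (e : S.NormalBundle) :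
    ∃ v : TangentSpace 𝓘(ℝ, V) (S.incl e.1),
      ∀ F : S.vanishingIdeal, S.lin F e = vectorDer (S.incl e.1) v F.1 := by
  obtain ⟨x, v⟩ := e
  obtain ⟨v, rfl⟩ := S.normalMk_surjective x v
  exact ⟨v, fun F => rfl⟩

theorem lin_add (S : EmbeddedSubmanifold V N W M) (F G : S.vanishingIdeal) :
    S.lin (F + G) = S.lin F + S.lin G := by
  ext e
  obtain ⟨v, hv⟩ := S.exists_lin_eq_vectorDer e
  change S.lin (F + G) e = S.lin F e + S.lin G e
  rw [hv, hv, hv]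
  exact (isPointDer_vectorDer _ v).1.map_add _ _

/-- In the Leibniz rule for `d(gF)` the term with `dg` carries the factor `F`, which vanishes on
`M`. -/
theorem lin_mul (S : EmbeddedSubmanifold V N W M) (g : C^∞⟮𝓘(ℝ, V), N; ℝ⟯)
    (F : S.vanishingIdeal) : S.lin (g • F) = S.pullback g * S.lin F := by
  ext e
  obtain ⟨v, hv⟩ := S.exists_lin_eq_vectorDer e
  change S.lin (g • F) e = g (S.incl e.1) * S.lin F e
  rw [hv, hv]
  refine ((isPointDer_vectorDer _ v).2 g F.1).trans ?_
  rw [F.2 e.1, zero_mul, add_zero]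

end EmbeddedSubmanifold

namespace EmbeddedSubmanifold

/-! ## Adapted frames of functions -/

/-- The index type of the coordinates along `M`. -/
abbrev BaseIdx (W : Type*) [NormedAddCommGroup W] [NormedSpace ℝ W] : Type :=
  Fin (Module.finrank ℝ W)

/-- The index type of the coordinates transverse to `M`. -/
abbrev NormalIdx (V W : Type*) [NormedAddCommGroup V] [NormedSpace ℝ V]
    [NormedAddCommGroup W] [NormedSpace ℝ W] : Type :=
  Fin (Module.finrank ℝ V - Module.finrank ℝ W)

variable {V : Type*} [NormedAddCommGroup V] [NormedSpace ℝ V]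
  {N : Type*} [TopologicalSpace N] [ChartedSpace V N]
  {W : Type*} [NormedAddCommGroup W] [NormedSpace ℝ W]
  {M : Type*} [TopologicalSpace M] [ChartedSpace W M]
  [FiniteDimensional ℝ V] [FiniteDimensional ℝ W]
  [IsManifold 𝓘(ℝ, V) ∞ N] [IsManifold 𝓘(ℝ, W) ∞ M]
  {S : EmbeddedSubmanifold V N W M}

variable (V W) in
/-- A basis of the model space of the normal bundle. -/
def modelBasis : Module.Basis (BaseIdx W ⊕ NormalIdx V W) ℝ (W × NormalModel V W) :=
  (Module.finBasis ℝ W).prod (EuclideanSpace.basisFun (NormalIdx V W) ℝ).toBasis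

variable (S) in
/-- A family of functions on `N` made of a family of functions and one of functions vanishing
on `M`. -/
def ambientFun (ξ : BaseIdx W → C^∞⟮𝓘(ℝ, V), N; ℝ⟯) (η : NormalIdx V W → S.vanishingIdeal) :
    BaseIdx W ⊕ NormalIdx V W → C^∞⟮𝓘(ℝ, V), N; ℝ⟯ :=
  Sum.elim ξ fun i => (η i).1

variable (S) in
/-- The corresponding family of functions on the normal bundle. -/
def normalFun (ξ : BaseIdx W → C^∞⟮𝓘(ℝ, V), N; ℝ⟯) (η : NormalIdx V W → S.vanishingIdeal) :
    BaseIdx W ⊕ NormalIdx V W → S.NormalFun :=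
  Sum.elim (fun a => S.pullback (ξ a)) fun i => S.lin (η i)

variable (S) in
/-- The functions `ξ` and `η` behave as adapted coordinates at a point `x` of `M`. -/
structure IsFrameAt (ξ : BaseIdx W → C^∞⟮𝓘(ℝ, V), N; ℝ⟯)
    (η : NormalIdx V W → S.vanishingIdeal) (x : M) : Prop where
  ambient_ext : ∀ D, IsPointDer (S.incl x) D → (∀ a, D (ξ a) = 0) → (∀ i, D (η i) = 0) →
    ∀ f, D f = 0
  ideal_span : ∀ F : S.vanishingIdeal, ∃ g : NormalIdx V W → C^∞⟮𝓘(ℝ, V), N; ℝ⟯,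
    ∀ᶠ p in 𝓝 (S.incl x), F.1 p = (∑ i, g i • η i : S.vanishingIdeal).1 p
  normal_ext : ∀ (v : S.NormalSpace x) (D : S.NormalFun → ℝ),
    IsPointDer (⟨x, v⟩ : S.NormalBundle) D →
    (∀ a, D (S.pullback (ξ a)) = 0) → (∀ i, D (S.lin (η i)) = 0) → ∀ f, D f = 0
  exists_derivations : ∀ v : S.NormalSpace x,
    ∃ D : BaseIdx W ⊕ NormalIdx V W → Derivation ℝ S.NormalFun S.NormalFun,
      ∀ᶠ e in 𝓝 (⟨x, v⟩ : S.NormalBundle), ∀ k l,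
        D k (S.normalFun ξ η l) e = if k = l then 1 else 0
  exists_lin_ne_zero : ∀ v : S.NormalSpace x, v ≠ 0 → ∃ i, S.lin (η i) ⟨x, v⟩ ≠ 0
  exists_tangent : ∀ r : BaseIdx W → ℝ, ∃ w : TangentSpace 𝓘(ℝ, W) x,
    ∀ a, vectorDer (S.incl x) (S.dincl x w) (ξ a) = r a

namespace AdaptedChart

variable (c : S.AdaptedChart)

/-- The functions `ξ` and `η` are adapted coordinates near a point `x` of `M`. -/
def IsCoordAt (ξ : BaseIdx W → C^∞⟮𝓘(ℝ, V), N; ℝ⟯)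
    (η : NormalIdx V W → S.vanishingIdeal) (x : M) : Prop :=
  x ∈ c.dom.source ∧ ∀ᶠ p in 𝓝 (S.incl x), ∀ k,
    S.ambientFun ξ η k p = (modelBasis V W).coord k (c.split.symm (c.cod p))

theorem modelBasis_coord_inr (z : W × NormalModel V W) (i : NormalIdx V W) :
    (modelBasis V W).coord (Sum.inr i) z = z.2 i := by
  rw [modelBasis, Module.Basis.coord_apply, Module.Basis.prod_repr_inr]
  rfl

theorem modelBasis_coord_inl (z : W × NormalModel V W) (a : BaseIdx W) :
    (modelBasis V W).coord (Sum.inl a) z = (Module.finBasis ℝ W).repr z.1 a := by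
  rw [modelBasis, Module.Basis.coord_apply, Module.Basis.prod_repr_inl]

variable {c} {ξ : BaseIdx W → C^∞⟮𝓘(ℝ, V), N; ℝ⟯} {η : NormalIdx V W → S.vanishingIdeal} {x : M}

theorem IsCoordAt.eventually (h : c.IsCoordAt ξ η x) : ∀ᶠ x' in 𝓝 x, c.IsCoordAt ξ η x' :=
  Filter.Eventually.and (c.dom.open_source.mem_nhds h.1)
    ((S.isSmoothEmbedding.contMDiff.continuous.tendsto x).eventually h.2.eventually_nhds)

variable (c) in
theorem exists_isCoordAt [T2Space N] (hx : x ∈ c.dom.source) : ∃ ξ η, c.IsCoordAt ξ η x := by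
  obtain ⟨φ, hφ, hφM, -⟩ := c.exists_ambientCoords
  obtain ⟨χ, hχs, hχ1, hχ⟩ := φ.exists_extension ((hφM x).2 hx)
  choose ζ hζ using fun k => hχ ((modelBasis V W).coord k)
    (LinearMap.toContinuousLinearMap ((modelBasis V W).coord k)).contDiff.contDiffOn
  refine ⟨fun a => ζ (Sum.inl a), fun i => ⟨ζ (Sum.inr i), fun x' => ?_⟩, hx, ?_⟩
  -- The cut-off transverse coordinates vanish on all of `M`: inside the chart `M` is their zero
  -- set, and outside the cutoff is zero.
  · rw [hζ]
    by_cases h : S.incl x' ∈ φ.source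
    · rw [hφ, c.split_symm_cod ((hφM x').1 h), modelBasis_coord_inr]
      simp
    · rw [image_eq_zero_of_notMem_tsupport fun h' => h (hχs h'), zero_mul]
  · filter_upwards [hχ1] with p hp k
    have h1 : ζ k p = (modelBasis V W).coord k (c.split.symm (c.cod p)) := by
      rw [hζ, hp, one_mul, hφ]
    rcases k with a | i <;> exact h1

/-- Read in the chart, `η i` is locally a linear function and hence equals its own derivative. The
linearized transverse coordinates are therefore the fiber coordinates of the trivialization. -/
theorem IsCoordAt.lin_apply (h : c.IsCoordAt ξ η x) (v : S.NormalSpace x) (i : NormalIdx V W) :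
    S.lin (η i) ⟨x, v⟩ = (c.triv ⟨x, v⟩).2 i := by
  refine (S.conormal_eq (η i) c h.1 v).trans ?_
  let L : V →L[ℝ] ℝ := (LinearMap.toContinuousLinearMap ((modelBasis V W).coord (Sum.inr i))).comp
    (c.split.symm : V →L[ℝ] W × NormalModel V W)
  have hs : c.cod (S.incl x) ∈ c.cod.target := c.cod.map_source (c.source_subset h.1)
  have h1 : ((η i).1 ∘ c.cod.symm) =ᶠ[𝓝 (c.cod (S.incl x))] L := by
    have ht : Filter.Tendsto c.cod.symm (𝓝 (c.cod (S.incl x))) (𝓝 (S.incl x)) := by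
      have := c.cod.symm.continuousAt hs
      rwa [ContinuousAt, c.cod.left_inv (c.source_subset h.1)] at this
    filter_upwards [ht.eventually h.2, c.cod.open_target.mem_nhds hs] with z hz hz'
    refine (hz (Sum.inr i)).trans ?_
    rw [c.cod.right_inv hz']
    rfl
  rw [h1.fderiv_eq, L.fderiv]
  change (modelBasis V W).coord (Sum.inr i) (c.split.symm (c.split (0, (c.triv ⟨x, v⟩).2))) = _
  rw [ContinuousLinearEquiv.symm_apply_apply, modelBasis_coord_inr]

theorem IsCoordAt.normalFun_apply (h : c.IsCoordAt ξ η x) (v : S.NormalSpace x)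
    (k : BaseIdx W ⊕ NormalIdx V W) :
    S.normalFun ξ η k ⟨x, v⟩ = (modelBasis V W).coord k (c.dom x, (c.triv ⟨x, v⟩).2) := by
  rcases k with a | i
  · refine (h.2.self_of_nhds (Sum.inl a)).trans ?_
    rw [c.split_symm_cod h.1, modelBasis_coord_inl, modelBasis_coord_inl]
  · rw [modelBasis_coord_inr]
    exact h.lin_apply v i

/-- The same indexed family gives coordinates on `N` and, after pullback and linearization, on the
normal bundle; each frame property is read off in one of these two charts. -/
theorem IsCoordAt.isFrameAt [T2Space N] (h : c.IsCoordAt ξ η x) : S.IsFrameAt ξ η x := by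
  obtain ⟨φ, hφ, hφM, hφ0⟩ := c.exists_ambientCoords
  obtain ⟨ψ, hψ, hψM⟩ := c.exists_normalCoords
  have hψc : ∀ (v : S.NormalSpace x) k, ∀ᶠ e in 𝓝 (⟨x, v⟩ : S.NormalBundle),
      S.normalFun ξ η k e = (modelBasis V W).coord k (ψ e) := by
    intro v k
    have hc : Continuous (TotalSpace.proj : S.NormalBundle → M) :=
      FiberBundle.continuous_proj _ _
    filter_upwards [(hc.tendsto ⟨x, v⟩).eventually h.eventually] with e he
    rw [hψ]
    exact IsCoordAt.normalFun_apply he e.2 k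
  have hp : S.incl x ∈ φ.source := (hφM x).2 h.1
  have hφc : ∀ k, ∀ᶠ p in 𝓝 (S.incl x),
      S.ambientFun ξ η k p = (modelBasis V W).coord k (φ p) := fun k => by
    filter_upwards [h.2] with p hp
    rw [hφ, hp k]
  refine ⟨fun D hD hξ hη => ?_, fun F => ?_, fun v D hD hξ hη => ?_, fun v => ?_, fun v hv => ?_,
    fun r => ?_⟩
  · refine φ.eq_zero_of_coord_eq_zero hp (modelBasis V W) (S.ambientFun ξ η) hφc hD ?_
    rintro (a | i)
    exacts [hξ a, hη i]
  -- Hadamard's lemma relative to the projection `(w, u) ↦ (w, 0)` onto `M`, where `F` vanishes. The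
  -- difference `φ - r ∘ φ` has no component along `M`, so only transverse coordinates remain in the
  -- sum.
  · obtain ⟨g, hg⟩ := φ.exists_local_hadamard hp F.1 (r := fun z => (z.1, 0))
      (contDiff_fst.prodMk contDiff_const) (c := 0) (fun z _ hz => by
        obtain ⟨x', hx'⟩ := hφ0 _ hz rfl
        rw [← hx', F.2 x']) (by rw [hφ, c.split_symm_cod h.1]) (modelBasis V W)
    refine ⟨fun i => g (Sum.inr i), ?_⟩
    filter_upwards [hg, h.2] with p h1 h2
    rw [h1, zero_add, Fintype.sum_sum_type]
    have h3 : ((∑ i, g (Sum.inr i) • η i : S.vanishingIdeal) : C^∞⟮𝓘(ℝ, V), N; ℝ⟯) p =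
        ∑ i, g (Sum.inr i) p * (η i).1 p := by
      rw [AddSubmonoidClass.coe_finsetSum]
      exact map_sum (ContMDiffMap.evalRingHom (I := 𝓘(ℝ, V)) (n := ∞) (R := ℝ) p)
        (fun i => g (Sum.inr i) * (η i).1) Finset.univ
    rw [h3, Finset.sum_eq_zero, zero_add]
    · refine Finset.sum_congr rfl fun i _ => ?_
      have h4 := h2 (Sum.inr i)
      rw [← hφ, modelBasis_coord_inr] at h4
      rw [modelBasis_coord_inr]
      congr 1
      refine Eq.trans ?_ h4.symm
      simp
    · intro a _
      rw [modelBasis_coord_inl]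
      simp
  · refine ψ.eq_zero_of_coord_eq_zero ((hψM _).2 h.1) (modelBasis V W) (S.normalFun ξ η) (hψc v)
      hD ?_
    rintro (a | i)
    exacts [hξ a, hη i]
  · exact ψ.exists_coord_derivations ((hψM _).2 h.1) (modelBasis V W) (S.normalFun ξ η) (hψc v)
  · by_contra! h0
    apply hv
    have h1 : (c.triv ⟨x, v⟩).2 = c.fiberEquiv h.1 v := by
      obtain ⟨v, rfl⟩ := S.normalMk_surjective x v
      rw [c.triv_apply h.1, c.fiberEquiv_mk]
    rw [← (c.fiberEquiv h.1).map_eq_zero_iff, ← h1]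
    ext i
    rw [← h.lin_apply v i, h0 i]
    rfl
  · obtain ⟨w, hw⟩ := c.dom_mdiff.mfderiv_surjective h.1
      (∑ a, r a • Module.finBasis ℝ W a)
    refine ⟨w, fun a => ?_⟩
    let L : V →L[ℝ] ℝ :=
      (LinearMap.toContinuousLinearMap ((modelBasis V W).coord (Sum.inl a))).comp
        (c.split.symm : V →L[ℝ] W × NormalModel V W)
    have h1 : HasMFDerivAt 𝓘(ℝ, V) 𝓘(ℝ, ℝ) (L ∘ c.cod) (S.incl x) _ :=
      (L.hasMFDerivAt (x := c.cod (S.incl x))).comp _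
        (c.cod_mdiff.mdifferentiableAt (c.source_subset h.1)).hasMFDerivAt
    have h2 : (ξ a : N → ℝ) =ᶠ[𝓝 (S.incl x)] L ∘ c.cod := by
      filter_upwards [h.2] with p hp
      exact hp (Sum.inl a)
    have h3 := (h1.congr_of_eventuallyEq h2).mfderiv
    refine (congrArg (fun T => T (S.dincl x w)) h3).trans ?_
    change (modelBasis V W).coord (Sum.inl a) (c.split.symm
      (mfderiv 𝓘(ℝ, V) 𝓘(ℝ, V) c.cod (S.incl x) (S.dincl x w))) = r a
    rw [c.mfderiv_cod_dincl h.1, ContinuousLinearEquiv.symm_apply_apply, modelBasis_coord_inl]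
    change (Module.finBasis ℝ W).repr (mfderiv 𝓘(ℝ, W) 𝓘(ℝ, W) c.dom x w) a = r a
    rw [hw]
    exact congrFun ((Module.finBasis ℝ W).repr_sum_self r) a

end AdaptedChart

theorem exists_isFrameAt [T2Space N] (S : EmbeddedSubmanifold V N W M) (x : M) :
    ∃ ξ η, ∀ᶠ x' in 𝓝 x, S.IsFrameAt ξ η x' := by
  obtain ⟨c, hc⟩ := S.exists_adaptedChart x
  obtain ⟨ξ, η, h⟩ := c.exists_isCoordAt hc
  exact ⟨ξ, η, h.eventually.mono fun _ h' => h'.isFrameAt⟩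

end EmbeddedSubmanifold

/-! ## Multiderivations with given coefficients -/

namespace SymMultider

section ofCoeff

variable {A : Type*} [CommRing A] [Algebra ℝ A]

theorem prod_update {q : ℕ} {κ : Type*} (D : κ → Derivation ℝ A A) (J : Fin q → κ)
    (f : Fin q → A) (i : Fin q) (a : A) :
    ∏ j, D (J j) (update f i a j) = D (J i) a * ∏ j ∈ Finset.univ.erase i, D (J j) (f j) := by
  rw [← Finset.mul_prod_erase _ _ (Finset.mem_univ i), update_self]
  congr 1
  exact Finset.prod_congr rfl fun j hj => by rw [update_of_ne (Finset.ne_of_mem_erase hj)]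

/-- The symmetric multiderivation `f ↦ ∑_J c_J D_{J₁} f₁ ⋯ D_{J_q} f_q`. -/
def ofCoeff {q : ℕ} {κ : Type*} [Fintype κ] (D : κ → Derivation ℝ A A)
    (c : (Fin q → κ) → A) (hc : ∀ (σ : Equiv.Perm (Fin q)) J, c (J ∘ σ) = c J) :
    SymMultider A q :=
  ofFun (fun f => ∑ J : Fin q → κ, (∏ j, D (J j) (f j)) * c J)
    (fun f i a b => by
      simp only [prod_update, _root_.map_add, add_mul, Finset.sum_add_distrib])
    (fun f i r a => by
      simp only [prod_update, Derivation.map_smul, smul_mul_assoc, Finset.smul_sum])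
    (fun σ f => by
      refine Fintype.sum_equiv (Equiv.arrowCongr σ (Equiv.refl κ)) _ _ fun J => ?_
      have h1 : c (J ∘ σ.symm) = c J := by
        rw [← hc σ]
        simp [Function.comp_def]
      have h2 : ∏ j, D (J (σ.symm j)) (f j) = ∏ j, D (J j) (f (σ j)) := by
        rw [← Equiv.prod_comp σ]
        simp
      exact (congrArg₂ (· * ·) h2 h1).symm)
    (fun f i a b => by
      simp only [prod_update, Derivation.leibniz, smul_eq_mul, Finset.mul_sum,
        ← Finset.sum_add_distrib]
      exact Finset.sum_congr rfl fun J _ => by ring)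

theorem ofCoeff_apply {q : ℕ} {κ : Type*} [Fintype κ] (D : κ → Derivation ℝ A A)
    (c : (Fin q → κ) → A) (hc : ∀ (σ : Equiv.Perm (Fin q)) J, c (J ∘ σ) = c J) (f : Fin q → A) :
    ofCoeff D c hc f = ∑ J : Fin q → κ, (∏ j, D (J j) (f j)) * c J := rfl

/-- Used with `φ` the evaluation at a point: duality of `D` and `ζ` at that point alone suffices to
recover the coefficients there. -/
theorem map_ofCoeff_apply {q : ℕ} {κ : Type*} [Fintype κ] [DecidableEq κ]
    (D : κ → Derivation ℝ A A) (c : (Fin q → κ) → A)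
    (hc : ∀ (σ : Equiv.Perm (Fin q)) J, c (J ∘ σ) = c J) {B : Type*} [CommRing B] (φ : A →+* B)
    (ζ : κ → A) (hζ : ∀ k l, φ (D k (ζ l)) = if k = l then 1 else 0) (J : Fin q → κ) :
    φ (ofCoeff D c hc (ζ ∘ J)) = φ (c J) := by
  rw [ofCoeff_apply, map_sum, Finset.sum_eq_single J]
  · simp [map_prod, hζ]
  · intro J' _ hJ
    obtain ⟨j, hj⟩ := Function.ne_iff.1 hJ
    rw [map_mul, map_prod, Finset.prod_eq_zero (Finset.mem_univ j), zero_mul]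
    rw [Function.comp_apply, hζ, if_neg hj]
  · exact fun h => absurd (Finset.mem_univ J) h

end ofCoeff

section smooth

variable {E : Type*} [NormedAddCommGroup E] [NormedSpace ℝ E]
  {H : Type*} [TopologicalSpace H] {I : ModelWithCorners ℝ E H}
  {X : Type*} [TopologicalSpace X] [ChartedSpace H X]

theorem isPointDer {q : ℕ} (R : SymMultider C^∞⟮I, X; ℝ⟯ q) (f : Fin q → C^∞⟮I, X; ℝ⟯)
    (i : Fin q) (p : X) : IsPointDer p fun a => R (update f i a) p :=
  ⟨⟨fun a b => by rw [map_add]; rfl, fun c a => by rw [map_smul]; rfl⟩,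
    fun a b => congrArg (fun g : C^∞⟮I, X; ℝ⟯ => g p) (R.leibniz f i a b)⟩

theorem congr_update {q : ℕ} [FiniteDimensional ℝ E] [IsManifold I ∞ X] [T2Space X]
    (R : SymMultider C^∞⟮I, X; ℝ⟯ q) (f : Fin q → C^∞⟮I, X; ℝ⟯)
    (i : Fin q) {p : X} {a b : C^∞⟮I, X; ℝ⟯} (h : ∀ᶠ x in 𝓝 p, a x = b x) :
    ∀ᶠ x in 𝓝 p, R (update f i a) x = R (update f i b) x :=
  h.eventually_nhds.mono fun x hx => (R.isPointDer f i x).congr hx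

end smooth

end SymMultider

/-! ### Locality and homogeneity of linearization. -/

namespace EmbeddedSubmanifold

variable {V : Type*} [NormedAddCommGroup V] [NormedSpace ℝ V]
  {N : Type*} [TopologicalSpace N] [ChartedSpace V N]
  {W : Type*} [NormedAddCommGroup W] [NormedSpace ℝ W]
  {M : Type*} [TopologicalSpace M] [ChartedSpace W M]
  [FiniteDimensional ℝ V] [FiniteDimensional ℝ W]
  [IsManifold 𝓘(ℝ, V) ∞ N] [IsManifold 𝓘(ℝ, W) ∞ M]
  {S : EmbeddedSubmanifold V N W M}

theorem lin_congr {F G : S.vanishingIdeal} {e : S.NormalBundle}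
    (h : ∀ᶠ p in 𝓝 (S.incl e.1), F.1 p = G.1 p) : ∀ᶠ e' in 𝓝 e, S.lin F e' = S.lin G e' := by
  have hc : Continuous fun e : S.NormalBundle => S.incl e.1 :=
    S.isSmoothEmbedding.contMDiff.continuous.comp (FiberBundle.continuous_proj _ _)
  filter_upwards [(hc.tendsto e).eventually h.eventually_nhds] with e' he'
  obtain ⟨v, hv⟩ := S.exists_lin_eq_vectorDer e'
  rw [hv, hv]
  have he : (F.1 : N → ℝ) =ᶠ[𝓝 (S.incl e'.1)] G.1 := he'
  exact congrArg (fun T => T v) (he.mfderiv_eq (I := 𝓘(ℝ, V)) (I' := 𝓘(ℝ, ℝ)))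

variable (S) in
/-- The linearization, as an additive map. -/
def linHom : S.vanishingIdeal →+ S.NormalFun := AddMonoidHom.mk' S.lin S.lin_add

/-- It allows a slot filled with pullbacks to be treated as a point derivation on `N`. -/
theorem isPointDer_comp_pullback {e : S.NormalBundle} {D : S.NormalFun → ℝ}
    (hD : IsPointDer e D) : IsPointDer (S.incl e.1) fun g => D (S.pullback g) :=
  ⟨⟨fun a b => by rw [map_add, hD.1.map_add], fun c a => by rw [map_smul, hD.1.map_smul]⟩,
    fun a b => (congrArg D (map_mul S.pullback a b)).trans (hD.2 _ _)⟩

theorem lin_smul (c : ℝ) (F : S.vanishingIdeal) : S.lin (c • F) = c • S.lin F := by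
  ext e
  obtain ⟨v, hv⟩ := S.exists_lin_eq_vectorDer e
  change S.lin (c • F) e = c • S.lin F e
  rw [hv, hv]
  exact (isPointDer_vectorDer _ v).1.map_smul c F.1

theorem lin_comp_fiberScale (F : S.vanishingIdeal) (t : ℝ) :
    (S.lin F).comp (fiberScale (NormalModel V W) S.NormalSpace t) = t • S.lin F := by
  ext e
  exact (S.conormal F e.1).map_smul t e.2

/-! ## Uniqueness -/

section Uniqueness

variable [T2Space N]

/-- In one slot the difference of `R` and `R'` is a point derivation that kills all linearizations.
Off the zero section these already control the pullbacks, so they determine the derivation. -/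
theorem eq_of_lin_eq_of_ne_zero {q : ℕ} {R R' : SymMultider S.NormalFun q} {x : M}
    {v : S.NormalSpace x} (hv : v ≠ 0)
    (h : ∀ F : Fin q → S.vanishingIdeal,
      R (S.lin ∘ F) ⟨x, v⟩ = R' (S.lin ∘ F) ⟨x, v⟩) (f : Fin q → S.NormalFun) :
    R f ⟨x, v⟩ = R' f ⟨x, v⟩ := by
  obtain ⟨ξ, η, hfr⟩ := S.exists_isFrameAt x
  replace hfr := hfr.self_of_nhds
  refine SymMultider.forall_of_forall_update
    (Φ := fun f => R f (⟨x, v⟩ : S.NormalBundle) = R' f (⟨x, v⟩ : S.NormalBundle))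
    (C := fun _ => Set.range S.lin) (C' := fun _ => Set.univ) (fun _ => Set.subset_univ _)
    (fun f _ i hi => ?_) (fun f hf => ?_) f fun _ => trivial
  · have hD := (R.isPointDer f i (⟨x, v⟩ : S.NormalBundle)).sub (R'.isPointDer f i ⟨x, v⟩)
    have hl : ∀ F : S.vanishingIdeal, R (update f i (S.lin F)) (⟨x, v⟩ : S.NormalBundle) -
        R' (update f i (S.lin F)) (⟨x, v⟩ : S.NormalBundle) = 0 := fun F =>
      sub_eq_zero.2 (hi _ ⟨F, rfl⟩)
    have := hfr.normal_ext v _ hD (fun a => ?_) (fun i => hl _) (f i)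
    · rwa [update_eq_self, sub_eq_zero] at this
    -- Applying the difference to `lin (ξ a • η k)` leaves `lin (η k)` at the point times its value
    -- on `pullback (ξ a)`; the first factor is nonzero by the choice of `k`.
    · obtain ⟨k, hk⟩ := hfr.exists_lin_ne_zero v hv
      have h1 := hl (ξ a • η k)
      rw [lin_mul] at h1
      have h2 := (hD.2 (S.pullback (ξ a)) (S.lin (η k))).symm.trans h1
      simp only [hl, mul_zero, zero_add] at h2
      exact (mul_eq_zero.1 h2).resolve_left hk
  · choose F hF using hf
    rw [show f = S.lin ∘ F from funext fun j => (hF j).symm]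
    exact h F

/-- The point is approached within its fiber by nonzero vectors, which is possible because the fiber
has positive dimension. There the previous lemma applies, and continuity gives the equality in the
limit. -/
theorem eq_of_eventually_lin_eq (hcodim : Module.finrank ℝ W < Module.finrank ℝ V) {q : ℕ}
    {R R' : SymMultider S.NormalFun q} {e : S.NormalBundle}
    (h : ∀ᶠ e' in 𝓝 e, ∀ F : Fin q → S.vanishingIdeal,
      R (S.lin ∘ F) e' = R' (S.lin ∘ F) e') (f : Fin q → S.NormalFun) : R f e = R' f e := by
  have : Nontrivial (NormalModel V W) := by
    rw [← Module.finrank_pos_iff (R := ℝ), finrank_euclideanSpace_fin]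
    omega
  obtain ⟨x, v⟩ := e
  obtain ⟨c, hc⟩ := S.exists_adaptedChart x
  let g : NormalModel V W → S.NormalBundle := fun u => ⟨x, (c.fiberCLE hc).symm u⟩
  have hg : Continuous g :=
    (FiberBundle.continuous_totalSpaceMk (NormalModel V W) S.NormalSpace x).comp
      (c.fiberCLE hc).symm.continuous
  have hg0 : g (c.fiberCLE hc v) = ⟨x, v⟩ := by
    simp only [g, ContinuousLinearEquiv.symm_apply_apply]
  have hne : (𝓝[{0}ᶜ] (c.fiberCLE hc v)).NeBot :=
    mem_closure_iff_nhdsWithin_neBot.1 (dense_compl_singleton (0 : NormalModel V W) _)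
  have ht : ∀ k : S.NormalFun, Filter.Tendsto (fun u => k (g u)) (𝓝[{0}ᶜ] (c.fiberCLE hc v))
      (𝓝 (k ⟨x, v⟩)) := fun k => by
    have := (k.contMDiff.continuous.comp hg).tendsto (c.fiberCLE hc v)
    simp only [Function.comp_apply, hg0] at this
    exact this.mono_left nhdsWithin_le_nhds
  refine tendsto_nhds_unique_of_eventuallyEq (ht (R f)) (ht (R' f)) ?_
  have h1 := hg.tendsto (c.fiberCLE hc v)
  rw [hg0] at h1
  filter_upwards [nhdsWithin_le_nhds (h1.eventually h), self_mem_nhdsWithin] with u hu hu0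
  refine eq_of_lin_eq_of_ne_zero (fun h0 => hu0 ?_) hu f
  exact (c.fiberCLE hc).symm.map_eq_zero_iff.1 h0

theorem eq_of_lin_eq (hcodim : Module.finrank ℝ W < Module.finrank ℝ V) {q : ℕ}
    {R R' : SymMultider S.NormalFun q}
    (h : ∀ F : Fin q → S.vanishingIdeal, R (S.lin ∘ F) = R' (S.lin ∘ F)) : R = R' := by
  ext f e
  exact eq_of_eventually_lin_eq hcodim (Filter.Eventually.of_forall fun e' F => by rw [h F]) f

end Uniqueness

/-! ## Local existence -/

variable (S) in
/-- Functions vanishing on `M` are mapped by `P` to such functions. -/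
def PreservesIdeal {q : ℕ} (P : SymMultider C^∞⟮𝓘(ℝ, V), N; ℝ⟯ q) : Prop :=
  ∀ f : Fin q → C^∞⟮𝓘(ℝ, V), N; ℝ⟯, (∀ j, f j ∈ S.vanishingIdeal) → P f ∈ S.vanishingIdeal

section Local

variable [T2Space N] {ξ : BaseIdx W → C^∞⟮𝓘(ℝ, V), N; ℝ⟯} {η : NormalIdx V W → S.vanishingIdeal}
  {e : S.NormalBundle}

/-- Two operators on functions on the normal bundle and on `N` that satisfy compatible Leibniz
rules agree on the functions vanishing on `M` if they agree on generators of this ideal. -/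
theorem IsFrameAt.lin_eq (hfr : S.IsFrameAt ξ η e.1) {D : S.NormalFun → ℝ} (hD : IsPointDer e D)
    {D' : C^∞⟮𝓘(ℝ, V), N; ℝ⟯ → ℝ} (hlin : IsLinearMap ℝ D')
    (hloc : ∀ f g : C^∞⟮𝓘(ℝ, V), N; ℝ⟯, (∀ᶠ p in 𝓝 (S.incl e.1), f p = g p) → D' f = D' g)
    (hmul : ∀ (g : C^∞⟮𝓘(ℝ, V), N; ℝ⟯) (F : S.vanishingIdeal),
      D' (g * F.1) = g (S.incl e.1) * D' F.1 + S.lin F e * D (S.pullback g))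
    (hη : ∀ k, D (S.lin (η k)) = D' (η k).1) (F : S.vanishingIdeal) : D (S.lin F) = D' F.1 := by
  obtain ⟨g, hg⟩ := hfr.ideal_span F
  rw [hD.congr (lin_congr hg), hloc _ _ hg]
  have h1 : S.lin (∑ k, g k • η k) = ∑ k, S.pullback (g k) * S.lin (η k) := by
    rw [← Finset.sum_congr rfl fun k _ => S.lin_mul (g k) (η k)]
    exact map_sum S.linHom _ _
  have h2 : D' (∑ k, g k • η k : S.vanishingIdeal).1 = ∑ k, D' (g k * (η k).1) := by
    rw [AddSubmonoidClass.coe_finsetSum]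
    exact map_sum (hlin.mk' D') _ _
  rw [h1, h2, hD.map_sum]
  refine Finset.sum_congr rfl fun k _ => ?_
  rw [hD.2, hmul, hη, pullback_apply]

variable {q : ℕ} {P : SymMultider C^∞⟮𝓘(ℝ, V), N; ℝ⟯ q}

/-- The number of indices along `M`. -/
def baseCard {ι κ : Type*} {q : ℕ} (J : Fin q → ι ⊕ κ) : ℕ :=
  (Finset.univ.filter fun j => (J j).isLeft).card

theorem baseCard_comp {ι κ : Type*} {q : ℕ} (J : Fin q → ι ⊕ κ) (σ : Equiv.Perm (Fin q)) :
    baseCard (J ∘ σ) = baseCard J :=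
  Finset.card_equiv σ fun j => by simp

variable (S) in
open Classical in
/-- The linearization of functions vanishing on `M`, extended by zero to all functions. -/
def linExtend (f : C^∞⟮𝓘(ℝ, V), N; ℝ⟯) : S.NormalFun :=
  if h : f ∈ S.vanishingIdeal then S.lin ⟨f, h⟩ else 0

variable (ξ η P) in
/-- The coefficients of the linearization of `P` in adapted coordinates. -/
def linCoeff (J : Fin q → BaseIdx W ⊕ NormalIdx V W) : S.NormalFun :=
  if baseCard J = 0 then S.linExtend (P (S.ambientFun ξ η ∘ J))
  else if baseCard J = 1 then S.pullback (P (S.ambientFun ξ η ∘ J)) else 0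

theorem linCoeff_comp (σ : Equiv.Perm (Fin q)) (J : Fin q → BaseIdx W ⊕ NormalIdx V W) :
    linCoeff ξ η P (J ∘ σ) = linCoeff ξ η P J := by
  have h : P (S.ambientFun ξ η ∘ J ∘ σ) = P (S.ambientFun ξ η ∘ J) :=
    P.map_perm σ (S.ambientFun ξ η ∘ J)
  simp only [linCoeff, baseCard_comp, h]

variable {R : SymMultider S.NormalFun q}

/-- Two arguments pulled back from `N` give zero. On frame functions such a tuple has at least two
indices along `M`, whose coefficient is zero by definition; the frame properties extend this slot by
slot. -/
theorem IsFrameAt.apply_eq_zero (hfr : S.IsFrameAt ξ η e.1)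
    (hR : ∀ J, R (S.normalFun ξ η ∘ J) e = linCoeff ξ η P J e) {i₀ i₁ : Fin q} (hi : i₀ ≠ i₁)
    (f : Fin q → S.NormalFun)
    (hf : ∀ j, (j = i₀ ∨ j = i₁) → f j ∈ Set.range S.pullback) : R f e = 0 := by
  refine SymMultider.forall_of_forall_update (Φ := fun f => R f e = 0)
    (C := fun j => {a | ∃ k, ((j = i₀ ∨ j = i₁) → k.isLeft) ∧ a = S.normalFun ξ η k})
    (C' := fun j => {a | (j = i₀ ∨ j = i₁) → a ∈ Set.range S.pullback})
    (fun j => ?_) (fun f hf i hi => ?_) (fun f hf => ?_) f hf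
  · rintro a ⟨k | k, hk, rfl⟩ hj
    · exact ⟨ξ k, rfl⟩
    · simp at hk; omega
  · have hD := R.isPointDer f i e
    by_cases h : i = i₀ ∨ i = i₁
    · obtain ⟨g, hg⟩ := hf i h
      have := hfr.ambient_ext _ (isPointDer_comp_pullback hD)
        (fun a => hi _ ⟨Sum.inl a, fun _ => rfl, rfl⟩) (fun k => ?_) g
      · simpa [hg] using this
      · rw [S.pullback_eq_zero (η k).2]
        exact hD.1.map_zero
    · have := hfr.normal_ext e.2 _ hD
        (fun a => hi _ ⟨Sum.inl a, fun h' => absurd h' h, rfl⟩)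
        (fun k => hi _ ⟨Sum.inr k, fun h' => absurd h' h, rfl⟩) (f i)
      simpa using this
  · choose J hJ hfJ using hf
    have hcard : 1 < baseCard J := by
      refine Finset.one_lt_card.2 ⟨i₀, ?_, i₁, ?_, hi⟩
      · simpa using hJ i₀ (Or.inl rfl)
      · simpa using hJ i₁ (Or.inr rfl)
    rw [show f = S.normalFun ξ η ∘ J from funext hfJ, hR, linCoeff, if_neg (by omega),
      if_neg (by omega)]
    rfl

/-- With exactly one pulled back argument, `R` reproduces the restriction of `P` to `M`. Slots hold
pairs (function on `N`, function on the normal bundle), so that both sides are propagated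
simultaneously. -/
theorem IsFrameAt.apply_pullback (hfr : S.IsFrameAt ξ η e.1) (hP : S.PreservesIdeal P)
    (hR : ∀ J, R (S.normalFun ξ η ∘ J) e = linCoeff ξ η P J e) (i₀ : Fin q)
    (s : Fin q → C^∞⟮𝓘(ℝ, V), N; ℝ⟯ × S.NormalFun) (h₀ : (s i₀).2 = S.pullback (s i₀).1)
    (hs : ∀ j, j ≠ i₀ → ∃ F : S.vanishingIdeal, s j = (F.1, S.lin F)) :
    R (Prod.snd ∘ s) e = P (Prod.fst ∘ s) (S.incl e.1) := by
  refine SymMultider.forall_of_forall_update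
    (Φ := fun s => R (Prod.snd ∘ s) e = P (Prod.fst ∘ s) (S.incl e.1))
    (C := fun j => {a | ∃ k, (k.isLeft = true ↔ j = i₀) ∧
      a = (S.ambientFun ξ η k, S.normalFun ξ η k)})
    (C' := fun j => {a | (j = i₀ → a.2 = S.pullback a.1) ∧
      (j ≠ i₀ → ∃ F : S.vanishingIdeal, a = (F.1, S.lin F))})
    (fun j => ?_) (fun s hs i hi => ?_) (fun s hs => ?_) s fun j => ⟨by rintro rfl; exact h₀, hs j⟩
  · rintro a ⟨k | k, hk, rfl⟩
    · exact ⟨fun _ => rfl, fun hj => absurd (hk.1 rfl) hj⟩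
    · exact ⟨fun hj => by simp [hj] at hk, fun _ => ⟨η k, rfl⟩⟩
  · have hD := R.isPointDer (Prod.snd ∘ s) i e
    have hD' := P.isPointDer (Prod.fst ∘ s) i (S.incl e.1)
    simp only [comp_update] at hi
    by_cases h : i = i₀
    · subst h
      have := hfr.ambient_ext _ ((isPointDer_comp_pullback hD).sub hD')
        (fun a => sub_eq_zero.2 (hi (ξ a, S.pullback (ξ a)) ⟨Sum.inl a, by simp, rfl⟩))
        (fun k => ?_) (s i).1
      · rw [← (hs i).1 rfl] at this
        have h1 : update (Prod.snd ∘ s) i (s i).2 = Prod.snd ∘ s := update_eq_self i _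
        have h2 : update (Prod.fst ∘ s) i (s i).1 = Prod.fst ∘ s := update_eq_self i _
        rwa [h1, h2, sub_eq_zero] at this
      -- With `η k` in the distinguished slot both sides vanish: its pullback is zero, and all
      -- arguments of `P` then lie in the ideal.
      · rw [S.pullback_eq_zero (η k).2, hD.1.map_zero, zero_sub, neg_eq_zero]
        refine hP _ (fun j => ?_) e.1
        by_cases hj : j = i
        · subst hj; rw [update_self]; exact (η k).2
        · rw [update_of_ne hj]
          obtain ⟨F, hF⟩ := (hs j).2 hj
          simp only [Function.comp_apply, hF]
          exact F.2
    · obtain ⟨F, hF⟩ := (hs i).2 h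
      have := hfr.lin_eq hD hD'.1 (fun f g hfg => hD'.congr hfg) (fun g F => ?_)
        (fun k => hi ((η k).1, S.lin (η k)) ⟨Sum.inr k, by simp [h], rfl⟩) F
      · have h1 : update (Prod.snd ∘ s) i (S.lin F) = Prod.snd ∘ s := by
          rw [update_eq_iff]; simp [hF]
        have h2 : update (Prod.fst ∘ s) i F.1 = Prod.fst ∘ s := by
          rw [update_eq_iff]; simp [hF]
        rwa [h1, h2] at this
      -- In the required Leibniz rule the extra term has pullbacks in the slots `i` and `i₀`, so it
      -- vanishes by `apply_eq_zero`; on the side of `P` the extra term carries the factor `F`, zero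
      -- on `M`.
      · refine (hD'.2 g F.1).trans ?_
        rw [F.2 e.1, zero_mul, hfr.apply_eq_zero hR h, mul_zero]
        rintro j (rfl | rfl)
        · rw [update_self]; exact ⟨g, rfl⟩
        · rw [update_of_ne (Ne.symm h)]
          exact ⟨_, ((hs j).1 rfl).symm⟩
  · choose J hJ hsJ using hs
    have hcard : baseCard J = 1 := by
      rw [baseCard, Finset.card_eq_one]
      exact ⟨i₀, by ext j; simp [hJ j]⟩
    rw [show Prod.snd ∘ s = S.normalFun ξ η ∘ J from funext fun j => by simp [hsJ j],
      show Prod.fst ∘ s = S.ambientFun ξ η ∘ J from funext fun j => by simp [hsJ j], hR, linCoeff,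
      if_neg (by omega), if_pos hcard]
    rfl

/-- The value of `lin` at `e` is differentiation along a vector `v`. On transverse coordinates the
identity is the definition of the coefficients. Replacing one of them by `g * F` produces a term
with `g` in the slot, which `apply_pullback` supplies. -/
theorem IsFrameAt.apply_lin (hfr : S.IsFrameAt ξ η e.1) (hP : S.PreservesIdeal P)
    (hR : ∀ J, R (S.normalFun ξ η ∘ J) e = linCoeff ξ η P J e) (F : Fin q → S.vanishingIdeal) :
    R (S.lin ∘ F) e = S.lin ⟨P (fun j => (F j).1), hP _ fun j => (F j).2⟩ e := by
  obtain ⟨v, hv⟩ := S.exists_lin_eq_vectorDer e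
  rw [hv]
  have hδ := isPointDer_vectorDer (S.incl e.1) v
  refine SymMultider.forall_of_forall_update
    (Φ := fun s : Fin q → C^∞⟮𝓘(ℝ, V), N; ℝ⟯ × S.NormalFun =>
      R (Prod.snd ∘ s) e = vectorDer (S.incl e.1) v (P (Prod.fst ∘ s)))
    (C := fun j => {a | ∃ k, a = ((η k).1, S.lin (η k))})
    (C' := fun j => {a | ∃ F : S.vanishingIdeal, a = (F.1, S.lin F)})
    (fun j => ?_) (fun s hs i hi => ?_) (fun s hs => ?_) (fun j => ((F j).1, S.lin (F j)))
    fun j => ⟨F j, rfl⟩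
  · rintro a ⟨k, rfl⟩
    exact ⟨η k, rfl⟩
  · have hD := R.isPointDer (Prod.snd ∘ s) i e
    have hmem : ∀ F : S.vanishingIdeal, P (update (Prod.fst ∘ s) i F.1) ∈ S.vanishingIdeal :=
      fun F => hP _ fun j => by
        by_cases hj : j = i
        · subst hj; rw [update_self]; exact F.2
        · rw [update_of_ne hj]
          obtain ⟨F, hF⟩ := hs j
          simp only [Function.comp_apply, hF]
          exact F.2
    simp only [comp_update] at hi
    obtain ⟨F, hF⟩ := hs i
    have := hfr.lin_eq hD (D' := fun f => vectorDer (S.incl e.1) v (P (update (Prod.fst ∘ s) i f)))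
      ⟨fun a b => by rw [P.map_add, hδ.1.map_add], fun c a => by rw [P.map_smul, hδ.1.map_smul]⟩
      (fun f g hfg => hδ.congr (P.congr_update _ i hfg)) (fun g F => ?_)
      (fun k => hi _ ⟨k, rfl⟩) F
    · have h1 : update (Prod.snd ∘ s) i (S.lin F) = Prod.snd ∘ s := by
        rw [update_eq_iff]; simp [hF]
      have h2 : update (Prod.fst ∘ s) i F.1 = Prod.fst ∘ s := by
        rw [update_eq_iff]; simp [hF]
      rwa [h1, h2] at this
    -- Expanding `v(P(gF)) = v(g P(F) + F P(g))` gives four terms. Two vanish since `P(F)` and `F`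
    -- are zero on `M`; in the last, `P(g)` on `M` equals `R` on the pullback of `g`.
    · have h3 := hfr.apply_pullback hP hR i (update s i (g, S.pullback g)) (by simp)
        fun j hj => by rw [update_of_ne hj]; exact hs j
      simp only [comp_update] at h3
      rw [P.leibniz, hδ.1.map_add, hδ.2, hδ.2, h3, hmem F e.1, F.2 e.1, hv]
      ring
  · choose k hk using hs
    have hmem : P (S.ambientFun ξ η ∘ fun j => Sum.inr (k j)) ∈ S.vanishingIdeal :=
      hP _ fun j => (η (k j)).2
    rw [show Prod.snd ∘ s = S.normalFun ξ η ∘ fun j => Sum.inr (k j) from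
        funext fun j => by simp [hk j, normalFun],
      show Prod.fst ∘ s = S.ambientFun ξ η ∘ fun j => Sum.inr (k j) from
        funext fun j => by simp [hk j, ambientFun], hR, linCoeff,
      if_pos (by simp [baseCard]), linExtend, dif_pos hmem]
    exact hv _

/-- One frame is valid, and dual to one set of derivations, on a whole neighborhood of `e`, so the
pointwise lemma `apply_lin` applies at every nearby point. -/
theorem PreservesIdeal.exists_local (hP : S.PreservesIdeal P) (e : S.NormalBundle) :
    ∃ R : SymMultider S.NormalFun q, ∀ᶠ e' in 𝓝 e, ∀ F : Fin q → S.vanishingIdeal,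
      R (S.lin ∘ F) e' = S.lin ⟨P (fun j => (F j).1), hP _ fun j => (F j).2⟩ e' := by
  obtain ⟨ξ, η, hfr⟩ := S.exists_isFrameAt e.1
  obtain ⟨D, hD⟩ := hfr.self_of_nhds.exists_derivations e.2
  have hc : Continuous (TotalSpace.proj : S.NormalBundle → M) :=
    FiberBundle.continuous_proj _ _
  refine ⟨SymMultider.ofCoeff D (linCoeff ξ η P) linCoeff_comp, ?_⟩
  filter_upwards [(hc.tendsto e).eventually hfr, hD] with e' h1 h2 F
  exact h1.apply_lin hP (fun J => SymMultider.map_ofCoeff_apply D _ linCoeff_comp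
    (ContMDiffMap.evalRingHom e' : S.NormalFun →+* ℝ) _ h2 J) F

end Local

/-! ## Global existence -/

section Global

variable [T2Space N]

theorem PreservesIdeal.exists_lin (hcodim : Module.finrank ℝ W < Module.finrank ℝ V) {q : ℕ}
    {P : SymMultider C^∞⟮𝓘(ℝ, V), N; ℝ⟯ q} (hP : S.PreservesIdeal P) :
    ∃ R : SymMultider S.NormalFun q, ∀ F : Fin q → S.vanishingIdeal,
      R (S.lin ∘ F) = S.lin ⟨P (fun j => (F j).1), hP _ fun j => (F j).2⟩ := by
  choose R hR using hP.exists_local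
  have hloc : ∀ (f : Fin q → S.NormalFun) (e : S.NormalBundle),
      ∀ᶠ e' in 𝓝 e, R e' f e' = R e f e' := by
    intro f e
    filter_upwards [(hR e).eventually_nhds] with e' he'
    refine eq_of_eventually_lin_eq hcodim ?_ f
    filter_upwards [he', hR e'] with e'' h1 h2 F
    rw [h1, h2]
  -- At each point the value is taken from the local solution belonging to that point. By `hloc`
  -- this agrees nearby with one fixed solution, whence smoothness; the algebraic identities are
  -- inherited pointwise.
  let T : (Fin q → S.NormalFun) → S.NormalFun := fun f =>
    ⟨fun e => R e f e, fun e =>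
      ((R e f).contMDiff e).congr_of_eventuallyEq (hloc f e)⟩
  have hT : ∀ f e, T f e = R e f e := fun _ _ => rfl
  refine ⟨SymMultider.ofFun T ?_ ?_ ?_ ?_, fun F => ?_⟩
  · intro f i a b
    ext e
    exact ((R e).isPointDer f i e).1.map_add a b
  · intro f i c a
    ext e
    exact ((R e).isPointDer f i e).1.map_smul c a
  · intro σ f
    ext e
    rw [hT, hT, (R e).map_perm]
  · intro f i a b
    ext e
    exact ((R e).isPointDer f i e).2 a b
  · ext e
    exact (hR e).self_of_nhds F

end Global

end EmbeddedSubmanifold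

/-! ### Conjugation of multiderivations. -/

namespace SymMultider

variable {A : Type*} [CommRing A] [Algebra ℝ A]

/-- The conjugate of a multiderivation by an algebra homomorphism with a left inverse, multiplied
by a constant. -/
def conj {q : ℕ} (R : SymMultider A q) (α β : A →ₐ[ℝ] A) (h : ∀ a, β (α a) = a) (r : ℝ) :
    SymMultider A q :=
  ofFun (fun f => r • β (R (α ∘ f)))
    (fun f i a b => by
      rw [comp_update, comp_update, comp_update, _root_.map_add, R.map_add, _root_.map_add,
        smul_add])
    (fun f i c a => by
      rw [comp_update, comp_update, _root_.map_smul, R.map_smul, _root_.map_smul, smul_comm])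
    (fun σ f => by rw [← R.map_perm σ (α ∘ f)]; rfl)
    (fun f i a b => by
      rw [comp_update, comp_update, comp_update, map_mul, R.leibniz, _root_.map_add, map_mul,
        map_mul, h, h, smul_add, mul_smul_comm, mul_smul_comm])

theorem conj_apply {q : ℕ} (R : SymMultider A q) (α β : A →ₐ[ℝ] A) (h : ∀ a, β (α a) = a) (r : ℝ)
    (f : Fin q → A) : R.conj α β h r f = r • β (R (α ∘ f)) := rfl

end SymMultider

namespace EmbeddedSubmanifold

variable {V : Type*} [NormedAddCommGroup V] [NormedSpace ℝ V]
  {N : Type*} [TopologicalSpace N] [ChartedSpace V N]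
  {W : Type*} [NormedAddCommGroup W] [NormedSpace ℝ W]
  {M : Type*} [TopologicalSpace M] [ChartedSpace W M]
  [FiniteDimensional ℝ V] [FiniteDimensional ℝ W]
  [IsManifold 𝓘(ℝ, V) ∞ N] [IsManifold 𝓘(ℝ, W) ∞ M]
  {S : EmbeddedSubmanifold V N W M}

/-! ## Fiberwise linearity -/

variable (S) in
/-- The action of the fiberwise scalar multiplication on functions on the normal bundle. -/
def scaleHom (t : ℝ) : S.NormalFun →ₐ[ℝ] S.NormalFun where
  toFun f := f.comp (fiberScale (NormalModel V W) S.NormalSpace t)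
  map_one' := rfl
  map_mul' _ _ := rfl
  map_zero' := rfl
  map_add' _ _ := rfl
  commutes' _ := rfl

theorem scaleHom_scaleHom_inv {t : ℝ} (ht : t ≠ 0) (f : S.NormalFun) :
    S.scaleHom t (S.scaleHom t⁻¹ f) = f := by
  ext e
  change f ⟨e.1, t⁻¹ • t • e.2⟩ = f e
  rw [inv_smul_smul₀ ht]

/-- Fiberwise linearity is forced: the suitably normalized conjugate of `R` by the scaling has the
same values on linearizations as `R`, hence equals `R` by uniqueness. -/
theorem isFWL_of_lin [T2Space N] (hcodim : Module.finrank ℝ W < Module.finrank ℝ V) {q : ℕ}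
    {P : SymMultider C^∞⟮𝓘(ℝ, V), N; ℝ⟯ q} (hP : S.PreservesIdeal P)
    {R : SymMultider S.NormalFun q}
    (hR : ∀ F : Fin q → S.vanishingIdeal,
      R (S.lin ∘ F) = S.lin ⟨P (fun j => (F j).1), hP _ fun j => (F j).2⟩) :
    IsFWL (NormalModel V W) S.NormalSpace R := by
  intro t ht f
  have key : R.conj (S.scaleHom t⁻¹) (S.scaleHom t) (scaleHom_scaleHom_inv ht)
      (t ^ ((q : ℤ) - 1)) = R := by
    refine eq_of_lin_eq hcodim fun F => ?_
    have h1 : S.scaleHom t⁻¹ ∘ S.lin ∘ F = S.lin ∘ fun j => t⁻¹ • F j := by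
      funext j
      exact (lin_comp_fiberScale (F j) t⁻¹).trans (lin_smul t⁻¹ (F j)).symm
    have h2 : (⟨P (fun j => (t⁻¹ • F j).1), hP _ fun j => (t⁻¹ • F j).2⟩ : S.vanishingIdeal) =
        (t⁻¹ ^ q) • ⟨P (fun j => (F j).1), hP _ fun j => (F j).2⟩ := by
      ext1
      have := P.toMultilinearMap.map_smul_univ (fun _ => t⁻¹) (fun j => (F j).1)
      rw [Finset.prod_const, Finset.card_univ, Fintype.card_fin] at this
      exact this
    rw [SymMultider.conj_apply, h1, hR, hR, h2, lin_smul, _root_.map_smul]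
    have h3 : ∀ G : S.vanishingIdeal, S.scaleHom t (S.lin G) = t • S.lin G := fun G =>
      lin_comp_fiberScale G t
    rw [h3, smul_smul, smul_smul, zpow_sub₀ ht, zpow_natCast, zpow_one, inv_pow]
    -- The normalization `t ^ (q - 1)` cancels `t⁻¹` from each of the `q` arguments and `t` from the
    -- linear value.
    rw [show t ^ q / t * (t ^ q)⁻¹ * t = 1 by field_simp, one_smul]
  have h4 := congrArg (fun T : SymMultider S.NormalFun q => t ^ (1 - (q : ℤ)) • T f) key
  simp only [SymMultider.conj_apply, smul_smul] at h4
  rw [← zpow_add₀ ht, show (1 - (q : ℤ)) + (q - 1) = 0 by ring, zpow_zero, one_smul] at h4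
  exact h4

/-! ## Brackets -/

section Bracket

variable {p q : ℕ} {P : SymMultider C^∞⟮𝓘(ℝ, V), N; ℝ⟯ p} {Q : SymMultider C^∞⟮𝓘(ℝ, V), N; ℝ⟯ q}

theorem PreservesIdeal.eval_mem (hP : S.PreservesIdeal P) (s : Multiset S.vanishingIdeal) :
    P.eval (s.map Subtype.val) ∈ S.vanishingIdeal := by
  by_cases h : s.card = p
  · obtain ⟨f, rfl⟩ := SymMultider.exists_eq_map_univ h
    rw [Multiset.map_map, SymMultider.eval_map_univ]
    exact hP _ fun j => (f j).2
  · rw [P.eval_of_card_ne (by simpa using h)]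
    exact zero_mem _

/-- The value of a multivector on functions vanishing on `M`. -/
def PreservesIdeal.evalIdeal (hP : S.PreservesIdeal P) (s : Multiset S.vanishingIdeal) :
    S.vanishingIdeal := ⟨P.eval (s.map Subtype.val), hP.eval_mem s⟩

/-- The insertion of multivectors on functions vanishing on `M`. -/
def PreservesIdeal.insIdeal (hP : S.PreservesIdeal P) (hQ : S.PreservesIdeal Q)
    (s : Multiset S.vanishingIdeal) : S.vanishingIdeal :=
  splitSum (fun t u => hP.evalIdeal (hQ.evalIdeal t ::ₘ u)) s

theorem PreservesIdeal.coe_insIdeal (hP : S.PreservesIdeal P) (hQ : S.PreservesIdeal Q)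
    (s : Multiset S.vanishingIdeal) :
    (hP.insIdeal hQ s : C^∞⟮𝓘(ℝ, V), N; ℝ⟯) = P.ins Q (s.map Subtype.val) := by
  rw [SymMultider.ins, splitSum_map]
  refine (map_splitSum (AddSubmonoidClass.subtype S.vanishingIdeal) _ s).trans
    (splitSum_congr fun t u _ => ?_)
  change P.eval ((hQ.evalIdeal t ::ₘ u).map Subtype.val) = _
  rw [Multiset.map_cons]
  rfl

theorem PreservesIdeal.bracket (hP : S.PreservesIdeal P) (hQ : S.PreservesIdeal Q) {n : ℕ}
    (h : p + q = n + 1) : S.PreservesIdeal (SymMultider.bracket h P Q) := by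
  intro f hf
  let s : Multiset S.vanishingIdeal := Finset.univ.val.map fun i => ⟨f i, hf i⟩
  have hs : Finset.univ.val.map f = s.map Subtype.val := by
    rw [Multiset.map_map]; rfl
  rw [SymMultider.bracket_apply, SymMultider.insertion_eq_ins, SymMultider.insertion_eq_ins, hs,
    ← hP.coe_insIdeal hQ, ← hQ.coe_insIdeal hP]
  exact sub_mem (hP.insIdeal hQ s).2 (hQ.insIdeal hP s).2

variable {P' : SymMultider S.NormalFun p} {Q' : SymMultider S.NormalFun q}

theorem PreservesIdeal.eval_map_lin (hP : S.PreservesIdeal P)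
    (hP' : ∀ F : Fin p → S.vanishingIdeal,
      P' (S.lin ∘ F) = S.lin ⟨P (fun j => (F j).1), hP _ fun j => (F j).2⟩)
    (s : Multiset S.vanishingIdeal) : P'.eval (s.map S.lin) = S.lin (hP.evalIdeal s) := by
  by_cases h : s.card = p
  · obtain ⟨F, rfl⟩ := SymMultider.exists_eq_map_univ h
    rw [Multiset.map_map, SymMultider.eval_map_univ, hP']
    congr 1
    ext1
    change _ = P.eval ((Finset.univ.val.map F).map Subtype.val)
    rw [Multiset.map_map, SymMultider.eval_map_univ]
    rfl
  · rw [P'.eval_of_card_ne (by simpa using h)]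
    have h0 : hP.evalIdeal s = 0 := by
      ext1
      exact P.eval_of_card_ne (by simpa using h)
    rw [h0]
    exact S.linHom.map_zero.symm

theorem PreservesIdeal.ins_map_lin (hP : S.PreservesIdeal P) (hQ : S.PreservesIdeal Q)
    (hP' : ∀ F : Fin p → S.vanishingIdeal,
      P' (S.lin ∘ F) = S.lin ⟨P (fun j => (F j).1), hP _ fun j => (F j).2⟩)
    (hQ' : ∀ F : Fin q → S.vanishingIdeal,
      Q' (S.lin ∘ F) = S.lin ⟨Q (fun j => (F j).1), hQ _ fun j => (F j).2⟩)
    (s : Multiset S.vanishingIdeal) : P'.ins Q' (s.map S.lin) = S.lin (hP.insIdeal hQ s) := by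
  rw [SymMultider.ins, splitSum_map]
  refine Eq.trans (splitSum_congr fun t u _ => ?_) (map_splitSum S.linHom _ s).symm
  rw [hQ.eval_map_lin hQ', ← Multiset.map_cons, hP.eval_map_lin hP']
  rfl

/-- `lin` is additive and intertwines `P` with `P'` and `Q` with `Q'`. In each term of an insertion
the inner value again vanishes on `M`, so the intertwining can be used a second time. -/
theorem PreservesIdeal.bracket_lin (hP : S.PreservesIdeal P) (hQ : S.PreservesIdeal Q)
    (hP' : ∀ F : Fin p → S.vanishingIdeal,
      P' (S.lin ∘ F) = S.lin ⟨P (fun j => (F j).1), hP _ fun j => (F j).2⟩)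
    (hQ' : ∀ F : Fin q → S.vanishingIdeal,
      Q' (S.lin ∘ F) = S.lin ⟨Q (fun j => (F j).1), hQ _ fun j => (F j).2⟩)
    {n : ℕ} (h : p + q = n + 1) (F : Fin n → S.vanishingIdeal) :
    SymMultider.bracket h P' Q' (S.lin ∘ F) =
      S.lin ⟨SymMultider.bracket h P Q (fun j => (F j).1),
        hP.bracket hQ h _ fun j => (F j).2⟩ := by
  have h1 : Finset.univ.val.map (S.lin ∘ F) = (Finset.univ.val.map F).map S.lin :=
    (Multiset.map_map _ _ _).symm
  have h2 : Finset.univ.val.map (fun j => (F j).1) =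
      (Finset.univ.val.map F).map Subtype.val := by
    rw [Multiset.map_map]; rfl
  rw [SymMultider.bracket_apply, SymMultider.insertion_eq_ins, SymMultider.insertion_eq_ins, h1,
    hP.ins_map_lin hQ hP' hQ', hQ.ins_map_lin hP hQ' hP']
  refine (S.linHom.map_sub _ _).symm.trans ?_
  change S.lin _ = S.lin _
  congr 1
  ext1
  change (hP.insIdeal hQ _ : C^∞⟮𝓘(ℝ, V), N; ℝ⟯) - (hQ.insIdeal hP _).1 =
    SymMultider.bracket h P Q (fun j => (F j).1)
  rw [hP.coe_insIdeal, hQ.coe_insIdeal, SymMultider.bracket_apply, SymMultider.insertion_eq_ins,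
    SymMultider.insertion_eq_ins, h2]

end Bracket

/-! ## Linearizable multivectors -/

section Linearizable

theorem IsLinearizable.preservesIdeal {q : ℕ} {P : SymMultider C^∞⟮𝓘(ℝ, V), N; ℝ⟯ q}
    (hP : S.IsLinearizable P) : S.PreservesIdeal P := by
  induction hP with
  | vectorField X hX =>
    intro f hf x
    obtain ⟨w, hw⟩ := hX x
    have h1 : f = fun _ => f 0 := funext fun i => by rw [Subsingleton.elim i 0]
    rw [h1, hw]
    exact S.mfderiv_apply_of_mem (hf 0) x _ ⟨w, rfl⟩
  | function F hF => exact fun f _ => hF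
  | zero q => exact fun f _ => zero_mem _
  | add P Q _ _ hP hQ => exact fun f hf => add_mem (hP f hf) (hQ f hf)
  | mul P Q _ hP =>
    intro f hf
    rw [SymMultider.mul_apply]
    -- In every term the factor coming from `P` has only vanishing arguments; nothing is needed of
    -- `Q`.
    refine sum_mem fun T _ => Ideal.mul_mem_right _ _ ?_
    have h1 : SymMultider.args f T =
        (T.val.map fun i => (⟨f i, hf i⟩ : S.vanishingIdeal)).map Subtype.val := by
      rw [Multiset.map_map]; rfl
    rw [h1]
    exact PreservesIdeal.eval_mem hP _

/-- At a point of `M` the derivation `X` kills the transverse coordinates, so it is determined by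
its values on the coordinates along `M`; some vector tangent to `M` has the same values. -/
theorem PreservesIdeal.isTangent [T2Space N] {X : SymMultider C^∞⟮𝓘(ℝ, V), N; ℝ⟯ 1}
    (hX : S.PreservesIdeal X) : S.IsTangent X := by
  intro x
  obtain ⟨ξ, η, hfr⟩ := S.exists_isFrameAt x
  replace hfr := hfr.self_of_nhds
  have hD : IsPointDer (S.incl x) fun f => X (fun _ => f) (S.incl x) := by
    have h1 := X.isPointDer 0 0 (S.incl x)
    have h2 : ∀ a : C^∞⟮𝓘(ℝ, V), N; ℝ⟯, update (0 : Fin 1 → _) 0 a = fun _ => a := fun a => by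
      funext i
      rw [Subsingleton.elim i 0, update_self]
    simpa only [h2] using h1
  obtain ⟨w, hw⟩ := hfr.exists_tangent fun a => X (fun _ => ξ a) (S.incl x)
  refine ⟨w, fun F => sub_eq_zero.1 ?_⟩
  refine hfr.ambient_ext _ (hD.sub (isPointDer_vectorDer _ (S.dincl x w)))
    (fun a => sub_eq_zero.2 (hw a).symm) (fun i => ?_) F
  have h1 : X (fun _ => (η i).1) (S.incl x) = 0 := hX _ (fun _ => (η i).2) x
  have h2 : vectorDer (S.incl x) (S.dincl x w) (η i).1 = 0 :=
    S.mfderiv_apply_of_mem (η i).2 x _ ⟨w, rfl⟩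
  rw [h1, h2, sub_zero]

theorem PreservesIdeal.isLinearizable_of_le_one [T2Space N] {n : ℕ} (hn : n ≤ 1)
    {P : SymMultider C^∞⟮𝓘(ℝ, V), N; ℝ⟯ n} (hP : S.PreservesIdeal P) : S.IsLinearizable P := by
  obtain rfl | rfl : n = 0 ∨ n = 1 := by omega
  -- In degree zero the ideal condition, on the empty tuple, says that the function vanishes on `M`.
  · have h1 : P = SymMultider.ofElem (P fun i => i.elim0) := by
      ext1 f
      rw [Subsingleton.elim f fun i => i.elim0]
      rfl
    rw [h1]
    exact .function _ (hP _ fun i => i.elim0)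
  · exact .vectorField _ hP.isTangent

/-- Transport along an equality of degrees. Comparing through `eval` keeps casts of index types out
of the Leibniz rule. -/
theorem IsLinearizable.exists_of_eq {m n : ℕ} (h : m = n)
    {P : SymMultider C^∞⟮𝓘(ℝ, V), N; ℝ⟯ m} (hP : S.IsLinearizable P) :
    ∃ P' : SymMultider C^∞⟮𝓘(ℝ, V), N; ℝ⟯ n, S.IsLinearizable P' ∧ ∀ s, P'.eval s = P.eval s := by
  subst h
  exact ⟨P, hP, fun _ => rfl⟩

theorem IsLinearizable.bracket_swap {p q n : ℕ} {P : SymMultider C^∞⟮𝓘(ℝ, V), N; ℝ⟯ p}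
    {Q : SymMultider C^∞⟮𝓘(ℝ, V), N; ℝ⟯ q} {h : p + q = n + 1}
    (hPQ : S.IsLinearizable (SymMultider.bracket ((add_comm q p).trans h) Q P)) :
    S.IsLinearizable (SymMultider.bracket h P Q) := by
  rw [SymMultider.bracket_swap]
  exact hPQ.mul _ _

/-- If brackets of `Q` with the generators of the ideal of linearizable multivectors are
linearizable, then so are brackets of `Q` with its other elements. -/
theorem IsLinearizable.bracket_of_generators {q : ℕ} {Q : SymMultider C^∞⟮𝓘(ℝ, V), N; ℝ⟯ q}
    (hX : ∀ X : SymMultider C^∞⟮𝓘(ℝ, V), N; ℝ⟯ 1, S.IsTangent X →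
      ∀ n (h : 1 + q = n + 1), S.IsLinearizable (SymMultider.bracket h X Q))
    (hF : ∀ F ∈ S.vanishingIdeal, ∀ n (h : 0 + q = n + 1),
      S.IsLinearizable (SymMultider.bracket h (SymMultider.ofElem F) Q))
    {p : ℕ} {P : SymMultider C^∞⟮𝓘(ℝ, V), N; ℝ⟯ p} (hP : S.IsLinearizable P) :
    ∀ n (h : p + q = n + 1), S.IsLinearizable (SymMultider.bracket h P Q) := by
  induction hP with
  | vectorField X h => exact hX X h
  | function F h => exact hF F h
  | zero p =>
    intro n h
    rw [SymMultider.zero_bracket]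
    exact .zero n
  | add P P' _ _ ih ih' =>
    intro n h
    rw [SymMultider.bracket_add_left]
    exact .add _ _ (ih n h) (ih' n h)
  | @mul p₁ p₂ P₁ P₂ hP₁ ih =>
    intro n h
    obtain ⟨A₁, hA₁, hA₁'⟩ : ∃ A : SymMultider C^∞⟮𝓘(ℝ, V), N; ℝ⟯ n, S.IsLinearizable A ∧
        ∀ s, A.eval s = splitSum (fun t u => (P₁.ins Q t - Q.ins P₁ t) * P₂.eval u) s := by
      -- If `p₁` and `q` are both zero there is no bracket of `P₁` and `Q`, and this half of the
      -- Leibniz rule vanishes for reasons of degree. Otherwise it is `{P₁, Q} ⊙ P₂`, linearizable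
      -- by induction.
      rcases Nat.eq_zero_or_pos (p₁ + q) with h0 | h0
      · refine ⟨0, .zero n, fun s => ?_⟩
        rw [SymMultider.eval_zero_apply, splitSum_eq_zero]
        intro t u _
        rw [SymMultider.ins_of_card_ne _ _ (by omega), SymMultider.ins_of_card_ne _ _ (by omega),
          sub_zero, zero_mul]
      · obtain ⟨m, hm⟩ : ∃ m, p₁ + q = m + 1 := ⟨p₁ + q - 1, by omega⟩
        obtain ⟨A, hA, hA'⟩ := ((ih m hm).mul _ P₂).exists_of_eq (n := n) (by omega)
        refine ⟨A, hA, fun s => ?_⟩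
        rw [hA', SymMultider.eval_mul]
        simp only [SymMultider.eval_bracket]
    obtain ⟨A₂, hA₂, hA₂'⟩ : ∃ A : SymMultider C^∞⟮𝓘(ℝ, V), N; ℝ⟯ n, S.IsLinearizable A ∧
        ∀ s, A.eval s = splitSum (fun t u => P₁.eval t * (P₂.ins Q u - Q.ins P₂ u)) s := by
      -- This half is `P₁ ⊙ {P₂, Q}`, which is in the ideal because `P₁` is; nothing is assumed of
      -- `P₂`.
      rcases Nat.eq_zero_or_pos (p₂ + q) with h0 | h0
      · refine ⟨0, .zero n, fun s => ?_⟩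
        rw [SymMultider.eval_zero_apply, splitSum_eq_zero]
        intro t u _
        rw [SymMultider.ins_of_card_ne _ _ (by omega), SymMultider.ins_of_card_ne _ _ (by omega),
          sub_zero, mul_zero]
      · obtain ⟨m, hm⟩ : ∃ m, p₂ + q = m + 1 := ⟨p₂ + q - 1, by omega⟩
        obtain ⟨A, hA, hA'⟩ :=
          (hP₁.mul _ (SymMultider.bracket hm P₂ Q)).exists_of_eq (n := n) (by omega)
        refine ⟨A, hA, fun s => ?_⟩
        rw [hA', SymMultider.eval_mul]
        simp only [SymMultider.eval_bracket]
    have hsum : SymMultider.bracket h (P₁.mul P₂) Q = A₁ + A₂ :=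
      SymMultider.eval_ext fun s => by
        rw [SymMultider.eval_bracket_mul, SymMultider.eval_add_apply, hA₁', hA₂']
    rw [hsum]
    exact .add _ _ hA₁ hA₂

/-- Reduction to generators is performed in each argument in turn, with antisymmetry in between. A
bracket of two generators has degree at most one, where preserving the vanishing ideal is enough. -/
theorem IsLinearizable.bracket [T2Space N] {p q n : ℕ} (h : p + q = n + 1)
    {P : SymMultider C^∞⟮𝓘(ℝ, V), N; ℝ⟯ p} {Q : SymMultider C^∞⟮𝓘(ℝ, V), N; ℝ⟯ q}
    (hP : S.IsLinearizable P) (hQ : S.IsLinearizable Q) :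
    S.IsLinearizable (SymMultider.bracket h P Q) := by
  have hgen : ∀ {k l : ℕ} {A : SymMultider C^∞⟮𝓘(ℝ, V), N; ℝ⟯ k}
      {B : SymMultider C^∞⟮𝓘(ℝ, V), N; ℝ⟯ l}, k ≤ 1 → l ≤ 1 → S.IsLinearizable A →
      S.IsLinearizable B → ∀ n (h : l + k = n + 1),
        S.IsLinearizable (SymMultider.bracket h B A) := fun hk hl hA hB n h =>
    (hB.preservesIdeal.bracket hA.preservesIdeal h).isLinearizable_of_le_one (by omega)
  have hgen' : ∀ {k : ℕ} {A : SymMultider C^∞⟮𝓘(ℝ, V), N; ℝ⟯ k}, k ≤ 1 → S.IsLinearizable A →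
      ∀ n (h : k + q = n + 1), S.IsLinearizable (SymMultider.bracket h A Q) :=
    fun hk hA n h => IsLinearizable.bracket_swap (bracket_of_generators
      (fun X hX => hgen hk le_rfl hA (.vectorField X hX))
      (fun F hF => hgen hk zero_le_one hA (.function F hF)) hQ n _)
  exact bracket_of_generators (fun X hX => hgen' le_rfl (.vectorField X hX))
    (fun F hF => hgen' zero_le_one (.function F hF)) hP n h

end Linearizable

end EmbeddedSubmanifold

end
-- The proposition.
theorem mainTheorem4
    {V : Type*} [NormedAddCommGroup V] [NormedSpace ℝ V] [FiniteDimensional ℝ V]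
    {N : Type*} [TopologicalSpace N] [ChartedSpace V N] [IsManifold 𝓘(ℝ, V) ∞ N]
    [T2Space N] [SecondCountableTopology N]
    {W : Type*} [NormedAddCommGroup W] [NormedSpace ℝ W] [FiniteDimensional ℝ W]
    {M : Type*} [TopologicalSpace M] [ChartedSpace W M] [IsManifold 𝓘(ℝ, W) ∞ M]
    (S : EmbeddedSubmanifold V N W M)
    (hcodim : Module.finrank ℝ W < Module.finrank ℝ V) :
    (∀ (q : ℕ) (P : SymMultider C^∞⟮𝓘(ℝ, V), N; ℝ⟯ q), S.IsLinearizable P →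
      ∃! R : SymMultider S.NormalFun q, S.IsLinearizationOf R P) ∧
    (∀ (p q n : ℕ) (h : p + q = n + 1)
      (P : SymMultider C^∞⟮𝓘(ℝ, V), N; ℝ⟯ p) (Q : SymMultider C^∞⟮𝓘(ℝ, V), N; ℝ⟯ q),
      S.IsLinearizable P → S.IsLinearizable Q →
      S.IsLinearizable (SymMultider.bracket h P Q) ∧
      ∀ (P' : SymMultider S.NormalFun p) (Q' : SymMultider S.NormalFun q),
        S.IsLinearizationOf P' P → S.IsLinearizationOf Q' Q →
        S.IsLinearizationOf (SymMultider.bracket h P' Q') (SymMultider.bracket h P Q)) := by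
  refine ⟨fun q P hP => ?_, fun p q n h P Q hP hQ => ⟨hP.bracket h hQ, fun P' Q' hP' hQ' => ?_⟩⟩
  · have hI := hP.preservesIdeal
    obtain ⟨R, hR⟩ := hI.exists_lin hcodim
    refine ⟨R, ⟨EmbeddedSubmanifold.isFWL_of_lin hcodim hI hR, fun F => ⟨_, hR F⟩⟩, fun R' hR' => ?_⟩
    refine EmbeddedSubmanifold.eq_of_lin_eq hcodim fun F => ?_
    obtain ⟨_, hF⟩ := hR'.2 F
    exact hF.trans (hR F).symm
  · have hPI := hP.preservesIdeal
    have hQI := hQ.preservesIdeal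
    have key := hPI.bracket_lin hQI (fun F => (hP'.2 F).choose_spec)
      (fun F => (hQ'.2 F).choose_spec) h
    exact ⟨EmbeddedSubmanifold.isFWL_of_lin hcodim (hPI.bracket hQI h) key, fun F => ⟨_, key F⟩⟩
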